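/- **Setting.** A tree-form decision problem is a finite rooted tree alternating between observation points (sequences) $\sigma\in\Sigma$, the root $\varnothing$ being one, and decision points $j\in\mathcal J$ with nonempty action sets $A_j$. The observation points other than $\varnothing$ are the pairs $ja$, $a\in A_j$; $p_j$ is the parent of $j$, $C_\sigma$ is the set of children of $\sigma$, and $d=|\Sigma|$. Let $\mathcal X\subset\{0,1\}^\Sigma$ be the set of sequence-form pure strategies and $\Phi_{\rm Lin}$ the set of linear maps $\mathcal X\to\operatorname{co}\mathcal X$. At each time $t=1,\dots,T$ the player chooses a distribution $\pi^{(t)}$ on $\mathcal X$ with mean $x^{(t)}$, and then a vector $u^{(t)}\in[0,1]^\Sigma$ with $\langle u^{(t)},x\rangle\in[0,1]$ for $x\in\mathcal X$ is revealed; the $\Phi$-regret is $\max_{\phi\in\Phi}\sum_{t\le T}\mathbb E_{x\sim\pi^{(t)}}\langle u^{(t)},\phi(x)-x\rangle$. In the *untimed communication (UTC) decision problem* a deviator at a decision point $v=(j,\tau)\in\mathcal J\times\Sigma$ (real state $j$, mediator state $\tau$) either plays an action $a\in A_j$ (moving to the observation point $(ja,\tau)$, then to $(j',\tau)$ for an observed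 $j'\in C_{ja}$) or queries some $k\in C_\tau$ (moving to $(j,ka)$, where $a$ is the action at $k$ recommended by the mediator's strategy $x\in\mathcal X$). The process starts at the observation point $(\varnothing,\varnothing)$. Let $n_v=|A_j|+|C_\tau|$. The functions $\mathcal X\to\operatorname{co}\mathcal X$ induced by mixed strategies of the deviator form the set $\Phi_{\rm UTC}$. The UTC polytope is the set of all pairs of nonnegative matrices $A\in\mathbb R^{\Sigma\times\Sigma}$, $B\in\mathbb R^{\mathcal J\times\mathcal J}$ with $A(\varnothing,\varnothing)=1$, $A(\varnothing,\tau)=0$ for $\tau\ne\varnothing$, and for all $(j,\tau)\in\mathcal J\times\Sigma$ $$A(p_j,\tau)+B(j,p_\tau)=\sum_{a\in A_j}A(ja,\tau)+\sum_{k\in C_\tau}B(j,k),\qquad B(j,p_\varnothing):=0 .$$ *Counterfactual regret minimization (CFR)* runs one deterministic external regret minimizer $R_v$ over the simplex of the $n_v$ choices at each UTC decision point $v$. In each iteration the local strategies are multiplied along the decision problem into a pair $(A^{(t)},B^{(t)})$, the player plays a fixed point $x^{(t)}=A^{(t)}x^{(t)}\in\operatorname{co}\mathcal X$, and each $R_v$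 receives the counterfactual utilities of its choices for the linear utility $A\mapsto\langle u^{(t)},Ax^{(t)}\rangle$. **Theorem.** For every tree-form decision problem: 1. The UTC polytope is obtained from a single point by successive scaled extensions (adjoining to $y$ the vectors $h(y)w$, $w$ in a simplex, with $h$ linear and nonnegative), one for each UTC decision point $v=(j,\tau)$, by the simplex of the choices at $v$ and with scaling $h=A(p_j,\tau)+B(j,p_\tau)$. 2. For any local regret minimizers $R_v$, the pairs $(A^{(t)},B^{(t)})$ lie in the UTC polytope, $\phi^{(t)}:x\mapsto A^{(t)}x$ is a UTC deviation and maps $\operatorname{co}\mathcal X$ to itself, and every linear map of $\operatorname{co}\mathcal X$ to itself has a fixed point in $\operatorname{co}\mathcal X$. If $R_v$ has regret at most $\rho_v(T)$ against all utility vectors in $[0,1]^{n_v}$, then for all $T$ the $\Phi_{\rm UTC}$-regret and the $\Phi_{\rm Lin}$-regret of the player are at most $\sum_v\rho_v(T)$. In particular, if $\rho_v(T)\le C\,n_v\sqrt T$ for all $v$, where $C\ge0$, both are at most $2C\,d^2\sqrt T$. Local regret minimizers with $\rho_v(T)=n_v\sqrt T$ exist. 3. Each iteration can be carried out by a fixed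 straight-line program that, besides one computation of a fixed point in $\operatorname{co}\mathcal X$ of $\phi^{(t)}:\operatorname{co}\mathcal X\to\operatorname{co}\mathcal X$ and one call of each local minimizer (next strategy, then observed utility), takes at most $Kd^2$ steps (arithmetic operations, and numbers exchanged with these subroutines), with a universal constant $K$. Hence, if the local minimizers take at most $C\,n_v$ steps per iteration, the cost of an iteration is at most $K+2C$ times the cost of the fixed-point computation, where the latter includes one step for each number of its $d\times d$ input and its output. -/

import Mathlib

open Finset

universe u

/-! ## Tree-form decision problems -/

/-- A finite tree-form decision problem.  `Dec` is the set of decision points and `Act j` the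
(nonempty) set of actions at `j`.  The observation points (sequences) are the root and the pairs
`(j, a)`; `parent j` is the observation point that precedes the decision point `j`.
`wf` says that these data form a tree: going up from any node ends at the root. -/
structure TreeFormDecisionProblem where
  Dec : Type u
  Act : Dec → Type u
  [decFintype : Fintype Dec]
  [decDecidableEq : DecidableEq Dec]
  [actFintype : ∀ j, Fintype (Act j)]
  [actDecidableEq : ∀ j, DecidableEq (Act j)]
  [actNonempty : ∀ j, Nonempty (Act j)]
  parent : Dec → Option (Sigma Act)
  wf : WellFounded (fun i j : Dec => ∃ a : Act i, parent j = some ⟨i, a⟩)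

namespace TreeFormDecisionProblem

attribute [instance] decFintype decDecidableEq actFintype actDecidableEq actNonempty

variable (P : TreeFormDecisionProblem.{u})

/-- Sequences (observation points); `none` is the root. -/
abbrev Seq : Type u := Option (Sigma P.Act)

/-- The root observation point. -/
abbrev root : P.Seq := none

/-- The sequence `ja`. -/
abbrev child (j : P.Dec) (a : P.Act j) : P.Seq := some ⟨j, a⟩

/-- `d`, the number of sequences. -/
def size : ℕ := Fintype.card P.Seq

/-- `C_σ`, the set of decision points that follow the observation point `σ`. -/
abbrev Next (σ : P.Seq) : Type u := {j : P.Dec // P.parent j = σ}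

variable {P} in
/-- `Selected plan σ`: the plan selects every action on the path from the root to `σ`. -/
inductive Selected (plan : ∀ j, P.Act j) : P.Seq → Prop
  | root : Selected plan P.root
  | step (j : P.Dec) : Selected plan (P.parent j) → Selected plan (P.child j (plan j))

open Classical in
/-- The sequence-form vector of a plan. -/
noncomputable def pureVector (plan : ∀ j, P.Act j) : P.Seq → ℝ :=
  fun σ => if Selected plan σ then 1 else 0

/-- The set of sequence-form pure strategies. -/
def X : Set (P.Seq → ℝ) := Set.range P.pureVector

noncomputable instance : Fintype P.X :=
  haveI : Finite P.X := Set.finite_range P.pureVector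
  Fintype.ofFinite _

/-- The set of sequence-form mixed strategies. -/
def coX : Set (P.Seq → ℝ) := convexHull ℝ P.X

/-! ## Deviations and regret -/

/-- Functions defined on the pure strategies. -/
abbrev Deviation : Type u := P.X → P.Seq → ℝ

/-- The linear deviations: the linear maps from `X` to `co X`. -/
def linearDeviations : Set P.Deviation :=
  {φ | (∀ x, φ x ∈ P.coX) ∧
    ∃ L : (P.Seq → ℝ) →ₗ[ℝ] (P.Seq → ℝ), ∀ x : P.X, φ x = L x}

/-- Admissible utility vectors: entries in `[0,1]`, and values in `[0,1]` on the strategies. -/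
def IsUtility (w : P.Seq → ℝ) : Prop :=
  (∀ σ, w σ ∈ Set.Icc (0 : ℝ) 1) ∧ ∀ x ∈ P.X, w ⬝ᵥ x ∈ Set.Icc (0 : ℝ) 1

variable {P} in
/-- The mean of a distribution on pure strategies. -/
noncomputable def mean (π : P.X → ℝ) : P.Seq → ℝ := ∑ x : P.X, π x • (x : P.Seq → ℝ)

variable {P} in
/-- `∑_{t < T} E_{x ∼ π t} ⟨w t, φ x - x⟩`. -/
noncomputable def regretAgainst (π : ℕ → P.X → ℝ) (w : ℕ → P.Seq → ℝ) (T : ℕ)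
    (φ : P.Deviation) : ℝ :=
  ∑ t ∈ range T, ∑ x : P.X, π t x * (w t ⬝ᵥ (φ x - x))

variable {P} in
/-- The `Φ`-regret after `T` steps (the maximum over `φ ∈ Φ`) is at most `r`. -/
def PhiRegretLE (Φ : Set P.Deviation) (π : ℕ → P.X → ℝ) (w : ℕ → P.Seq → ℝ) (T : ℕ)
    (r : ℝ) : Prop :=
  ∀ φ ∈ Φ, regretAgainst π w T φ ≤ r

/-! ## The untimed communication (UTC) decision problem -/

/-- Decision points `(j, τ)` of the UTC decision problem: `j` is the current decision point of the
real decision problem and the sequence `τ` is the state of the mediator. -/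
abbrev UDec : Type u := P.Dec × P.Seq

/-- The choices at `(j, τ)`: play an action at `j`, or query a decision point that follows `τ`. -/
abbrev Choice (v : P.UDec) : Type u := P.Act v.1 ⊕ P.Next v.2

/-- The nodes of the UTC decision problem. -/
inductive UNode : Type u
  | obs (σ τ : P.Seq) : UNode
  | dec (j : P.Dec) (τ : P.Seq) : UNode
  | query (j k : P.Dec) : UNode

/-- Pure strategies of the deviator. -/
abbrev PureDeviator : Type u := ∀ v : P.UDec, P.Choice v

variable {P} in
/-- The nodes that the deviator `s` can reach (for some observations in the real decision problem)
when the mediator recommends according to the pure strategy `x`. -/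
inductive Reaches (s : P.PureDeviator) (x : P.X) : P.UNode → Prop
  | root : Reaches s x (.obs P.root P.root)
  | observe (j : P.Dec) (τ : P.Seq) :
      Reaches s x (.obs (P.parent j) τ) → Reaches s x (.dec j τ)
  | play (j : P.Dec) (τ : P.Seq) (a : P.Act j) :
      Reaches s x (.dec j τ) → s (j, τ) = .inl a → Reaches s x (.obs (P.child j a) τ)
  | ask (j : P.Dec) (τ : P.Seq) (k : P.Next τ) :
      Reaches s x (.dec j τ) → s (j, τ) = .inr k → Reaches s x (.query j k)
  | reply (j k : P.Dec) (a : P.Act k) :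
      Reaches s x (.query j k) → (x : P.Seq → ℝ) (P.child k a) = 1 →
        Reaches s x (.dec j (P.child k a))

open Classical in
variable {P} in
/-- The function induced by a pure strategy of the deviator. -/
noncomputable def pureDeviation (s : P.PureDeviator) : P.Deviation :=
  fun x σ => if ∃ τ, Reaches s x (.obs σ τ) then 1 else 0

/-- The UTC deviations: the functions induced by mixed strategies of the deviator. -/
def utcDeviations : Set P.Deviation :=
  {φ | ∃ μ ∈ stdSimplex ℝ P.PureDeviator, φ = ∑ s, μ s • pureDeviation s}

/-! ## The UTC polytope -/

/-- Coordinates of a pair of matrices `(A, B)`, `A` indexed by `Seq × Seq` and `B` by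
`Dec × Dec`. -/
abbrev Coord : Type u := (P.Seq × P.Seq) ⊕ (P.Dec × P.Dec)

variable {P} in
/-- The matrix `A` of a pair `(A, B)`. -/
def devMatrix (z : P.Coord → ℝ) : Matrix P.Seq P.Seq ℝ :=
  Matrix.of fun σ τ => z (.inl (σ, τ))

variable {P} in
/-- `B(j, p_τ)`, which is `0` if `τ` is the root. -/
def queryMass (z : P.Coord → ℝ) (j : P.Dec) : P.Seq → ℝ
  | none => 0
  | some ⟨k, _⟩ => z (.inr (j, k))

variable {P} in
/-- The mass `A(p_j, τ) + B(j, p_τ)` that arrives at the UTC decision point `(j, τ)`. -/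
def arrival (v : P.UDec) (z : P.Coord → ℝ) : ℝ :=
  z (.inl (P.parent v.1, v.2)) + queryMass z v.1 v.2

variable {P} in
/-- The coordinate of a choice at `(j, τ)`: `A(ja, τ)` for an action `a`, `B(j, k)` for a
query `k`. -/
def choiceCoord (v : P.UDec) : P.Choice v → P.Coord
  | .inl a => .inl (P.child v.1 a, v.2)
  | .inr k => .inr (v.1, k)

/-- The polytope of all mixed sequence-form UTC deviations `(A, B)`. -/
def utcPolytope : Set (P.Coord → ℝ) :=
  {z | (∀ v : P.UDec, arrival v z = ∑ i, z (choiceCoord v i)) ∧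
    z (.inl (P.root, P.root)) = 1 ∧
    (∀ τ, τ ≠ P.root → z (.inl (P.root, τ)) = 0) ∧
    ∀ e, 0 ≤ z e}

/-- The starting point of the chain of scaled extensions: `A(root, root) = 1`. -/
def rootPoint : P.Coord → ℝ := Pi.single (.inl (P.root, P.root)) 1

/-- The coordinates `A(root, ·)`. -/
def rootCoords : Finset P.Coord := univ.image fun τ : P.Seq => .inl (P.root, τ)

end TreeFormDecisionProblem

/-! ## Scaled extensions -/

/-- The scaled extension of `S` by the simplex on the new coordinates `G`, with scaling `h`: all
`(y, h(y) • w)` with `y ∈ S` and `w` in the simplex.  Points of `S` vanish on `G`, and `w` vanishes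
off `G`, so that pairs are written as sums. -/
def scaledExtension {E : Type u} (S : Set (E → ℝ)) (h : (E → ℝ) → ℝ) (G : Finset E) :
    Set (E → ℝ) :=
  {z | ∃ y ∈ S, ∃ w : E → ℝ, (∀ e, 0 ≤ w e) ∧ (∀ e ∉ G, w e = 0) ∧ ∑ e ∈ G, w e = 1 ∧
    z = y + h y • w}

/-- `ScaledExtensionChain c F₀ l F S`: starting from the single point `c`, which lives on the
coordinates `F₀`, the successive scaled extensions by the simplices and scaling functions listed
in `l` (each on fresh coordinates, with a linear scaling function that is nonnegative on the set
built so far) give the set `S`, which lives on the coordinates `F`. -/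
inductive ScaledExtensionChain {E : Type u} [DecidableEq E] (c : E → ℝ) (F₀ : Finset E) :
    List (Finset E × ((E → ℝ) → ℝ)) → Finset E → Set (E → ℝ) → Prop
  | point (hc : ∀ e ∉ F₀, c e = 0) : ScaledExtensionChain c F₀ [] F₀ {c}
  | extend (l : List (Finset E × ((E → ℝ) → ℝ))) (F : Finset E) (S : Set (E → ℝ))
      (G : Finset E) (h : (E → ℝ) → ℝ) :
      ScaledExtensionChain c F₀ l F S → G.Nonempty → Disjoint F G → IsLinearMap ℝ h →
      (∀ y ∈ S, 0 ≤ h y) →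
      ScaledExtensionChain c F₀ (l ++ [(G, h)]) (F ∪ G) (scaledExtension S h G)

/-! ## Local regret minimizers and counterfactual regret minimization -/

/-- The utilities of the steps `0, …, t - 1`. -/
def history {ι : Type u} (g : ℕ → ι → ℝ) (t : ℕ) : List (ι → ℝ) := (List.range t).map g

/-- A deterministic online learner on the simplex over `ι`: it maps the list of the utility vectors
observed so far to the next strategy. -/
structure LocalMinimizer (ι : Type u) [Fintype ι] where
  next : List (ι → ℝ) → ι → ℝ
  next_mem : ∀ l, next l ∈ stdSimplex ℝ ι

/-- After `T` steps, the external regret of `R` is at most `ρ T`, for all utility vectors with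
entries in `[0,1]`. -/
def LocalMinimizer.HasRegret {ι : Type u} [Fintype ι] (R : LocalMinimizer ι) (ρ : ℕ → ℝ) : Prop :=
  ∀ (g : ℕ → ι → ℝ), (∀ t i, g t i ∈ Set.Icc (0 : ℝ) 1) → ∀ (T : ℕ), ∀ y ∈ stdSimplex ℝ ι,
    ∑ t ∈ range T, g t ⬝ᵥ (y - R.next (history g t)) ≤ ρ T

namespace TreeFormDecisionProblem

/-- A run of counterfactual regret minimization on the UTC decision problem, with the local
minimizer `R v` at the decision point `v`, that plays fixed points of its iterates against the
utilities `w`.  In step `t`, `strat t v` is the local strategy at `v`, `dev t` the resulting pair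
`(A, B)`, `x t` the mixed strategy that is played, `value t v` the counterfactual value of `v` and
`gain t v i` the counterfactual utility of the choice `i` at `v`, for the linear utility
`A ↦ ⟨w t, A (x t)⟩`. -/
structure CFRRun (P : TreeFormDecisionProblem.{u}) (R : ∀ v : P.UDec, LocalMinimizer (P.Choice v))
    (w : ℕ → P.Seq → ℝ) where
  strat : ℕ → ∀ v : P.UDec, P.Choice v → ℝ
  dev : ℕ → P.Coord → ℝ
  x : ℕ → P.Seq → ℝ
  gain : ℕ → ∀ v : P.UDec, P.Choice v → ℝ
  value : ℕ → P.UDec → ℝ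
  strat_eq : ∀ t v, strat t v = (R v).next (history (fun s => gain s v) t)
  dev_root : ∀ t, dev t (.inl (P.root, P.root)) = 1
  dev_root_of_ne : ∀ t τ, τ ≠ P.root → dev t (.inl (P.root, τ)) = 0
  dev_choice : ∀ t v i, dev t (choiceCoord v i) = strat t v i * arrival v (dev t)
  x_mem : ∀ t, x t ∈ P.coX
  x_fixed : ∀ t, (devMatrix (dev t)).mulVec (x t) = x t
  gain_play : ∀ t (j : P.Dec) (τ : P.Seq) (a : P.Act j),
    gain t (j, τ) (.inl a) =
      w t (P.child j a) * x t τ + ∑ k : P.Next (P.child j a), value t (k.1, τ)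
  gain_query : ∀ t (j : P.Dec) (τ : P.Seq) (k : P.Next τ),
    gain t (j, τ) (.inr k) = ∑ a : P.Act k.1, value t (j, P.child k.1 a)
  value_eq : ∀ t v, value t v = ∑ i, strat t v i * gain t v i

/-! ## Machine model: straight-line programs with oracle calls -/

variable (P : TreeFormDecisionProblem.{u})

/-- Registers: ports for the input `w t`, for the output `x t` of the fixed-point oracle, for its
input matrix, for the strategy and the utility vector exchanged with the local minimizers, and
work registers. -/
inductive Register : Type u
  | utility (σ : P.Seq) : Register
  | play (σ : P.Seq) : Register
  | matrix (σ τ : P.Seq) : Register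
  | strat (v : P.UDec) (i : P.Choice v) : Register
  | gain (v : P.UDec) (i : P.Choice v) : Register
  | work (n : ℕ) : Register

/-- Instructions: arithmetic on single registers, and oracle calls.  `ask v` loads the next
strategy of the local minimizer at `v`, `tell v` hands it a utility vector, and `fix` calls the
fixed-point oracle. -/
inductive Instr : Type u
  | const (dst : P.Register) (n : ℕ) : Instr
  | add (dst a b : P.Register) : Instr
  | mul (dst a b : P.Register) : Instr
  | ask (v : P.UDec) : Instr
  | tell (v : P.UDec) : Instr
  | fix : Instr

/-- Contents of the registers, and the utility vectors that the local minimizers have received. -/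
structure MachineState where
  mem : P.Register → ℝ
  hist : ∀ v : P.UDec, List (P.Choice v → ℝ)

variable {P}

/-- Store a real number in a register. -/
noncomputable def MachineState.store (s : P.MachineState) (r : P.Register) (c : ℝ) :
    P.MachineState :=
  letI := Classical.decEq P.Register
  { s with mem := Function.update s.mem r c }

/-- The effect of one instruction. -/
noncomputable def Instr.exec (R : ∀ v : P.UDec, LocalMinimizer (P.Choice v))
    (fixpt : Matrix P.Seq P.Seq ℝ → P.Seq → ℝ) (s : P.MachineState) :
    P.Instr → P.MachineState
  | .const dst n => s.store dst n
  | .add dst a b => s.store dst (s.mem a + s.mem b)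
  | .mul dst a b => s.store dst (s.mem a * s.mem b)
  | .ask v =>
      { s with mem := fun
          | .strat v' i => if v' = v then (R v').next (s.hist v') i else s.mem (.strat v' i)
          | r => s.mem r }
  | .tell v =>
      { s with hist := fun v' =>
          if v' = v then s.hist v' ++ [fun i => s.mem (.gain v' i)] else s.hist v' }
  | .fix =>
      { s with mem := fun
          | .play σ => fixpt (Matrix.of fun σ' τ' => s.mem (.matrix σ' τ')) σ
          | r => s.mem r }

/-- The number of steps of an instruction.  An arithmetic operation is one step; an oracle call
costs one step for each real number that is handed over, plus the running time of the oracle: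
`f` for the fixed-point oracle, `ca v` and `ct v` for the local minimizer at `v`. -/
def Instr.cost (f : ℕ) (ca ct : P.UDec → ℕ) : P.Instr → ℕ
  | .const _ _ => 1
  | .add _ _ _ => 1
  | .mul _ _ _ => 1
  | .ask v => Fintype.card (P.Choice v) + ca v
  | .tell v => Fintype.card (P.Choice v) + ct v
  | .fix => P.size ^ 2 + P.size + f

/-- The number of steps of a program. -/
def progCost (f : ℕ) (ca ct : P.UDec → ℕ) (p : List P.Instr) : ℕ :=
  (p.map (Instr.cost f ca ct)).sum

/-- Run a program. -/
noncomputable def runProg (R : ∀ v : P.UDec, LocalMinimizer (P.Choice v))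
    (fixpt : Matrix P.Seq P.Seq ℝ → P.Seq → ℝ) (p : List P.Instr) (s : P.MachineState) :
    P.MachineState :=
  p.foldl (Instr.exec R fixpt) s

/-- The environment writes a utility vector into the input port. -/
def MachineState.observe (s : P.MachineState) (w : P.Seq → ℝ) : P.MachineState :=
  { s with mem := fun
      | .utility σ => w σ
      | r => s.mem r }

/-- The state at the beginning of iteration `t`.  An iteration runs `p` (which produces the play),
then the utility vector is revealed, then `q` runs. -/
noncomputable def stateAt (R : ∀ v : P.UDec, LocalMinimizer (P.Choice v))
    (fixpt : Matrix P.Seq P.Seq ℝ → P.Seq → ℝ) (p q : List P.Instr) (w : ℕ → P.Seq → ℝ) :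
    ℕ → P.MachineState
  | 0 => { mem := fun _ => 0, hist := fun _ => [] }
  | t + 1 => runProg R fixpt q ((runProg R fixpt p (stateAt R fixpt p q w t)).observe (w t))

/-- The state in iteration `t` when the play has been produced, before the utility is revealed. -/
noncomputable def playState (R : ∀ v : P.UDec, LocalMinimizer (P.Choice v))
    (fixpt : Matrix P.Seq P.Seq ℝ → P.Seq → ℝ) (p q : List P.Instr) (w : ℕ → P.Seq → ℝ) (t : ℕ) :
    P.MachineState :=
  runProg R fixpt p (stateAt R fixpt p q w t)

/-- `fixpt` returns a fixed point in `co X` for every matrix that maps `co X` to `co X`. -/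
def IsFixedPointOracle (fixpt : Matrix P.Seq P.Seq ℝ → P.Seq → ℝ) : Prop :=
  ∀ M : Matrix P.Seq P.Seq ℝ, Set.MapsTo M.mulVec P.coX P.coX →
    fixpt M ∈ P.coX ∧ M.mulVec (fixpt M) = fixpt M

end TreeFormDecisionProblem

/-!
Multiplying local strategies along the UTC decision problem gives a point `(A, B)` of the UTC
polytope: each coordinate is the mass that arrives at its decision point times the local probability
of the choice. Adding the decision points in the order of their distance from the root builds the
polytope by scaled extensions. For a pure deviator, the product of `A` with a pure strategy `x`
records which observation points are reached against `x`; as in Kuhn's theorem, the pair that local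
strategies generate is the mean, over independent local choices, of the pairs of the pure deviators,
so that `x ↦ A x` is a UTC deviation.

The regret against a point of the polytope is a sum over the decision points: the counterfactual
values telescope, and what remains at `v` is the local regret weighted by an arriving mass, which is
at most one. Linear maps from `X` to `co X` are covered as well: on `X` a linear functional does not
change if `b k` is added at the parent of `k` and subtracted at the children of `k`, and backward
induction picks such `b` that the entries of every row of the matrix become nonnegative, with
minimum zero at each decision point. The row of `p_j` and the sum of the rows of `ja` agree on `X`,
hence differ by such a `b`, which is nonnegative; it is the row `B(j, ·)`.

In an iteration, a pass away from the root computes `(A, B)` and a pass towards the root computes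
the counterfactual utilities. The number of products that are summed up is linear in the total
number of choices, which is at most `2 * d ^ 2`.
-/

/-! ### Recursion, product distributions and fixed points -/

theorem wellFounded_apply_gt {ι : Type*} [Finite ι] (rank : ι → ℕ) :
    WellFounded fun i j => rank j < rank i := by
  have : IsTrans ι fun i j => rank j < rank i := ⟨fun _ _ _ hij hjk => hjk.trans hij⟩
  have : Std.Irrefl fun i j => rank j < rank i := ⟨fun _ => lt_irrefl _⟩
  exact Finite.wellFounded_of_trans_of_irrefl _

theorem exists_forall_eq_of_wellFounded {ι α : Type*} [Nonempty α] {r : ι → ι → Prop}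
    (hr : WellFounded r) (F : (ι → α) → ι → α)
    (hF : ∀ f g i, (∀ j, r j i → f j = g j) → F f i = F g i) : ∃ f, ∀ i, f i = F f i := by
  classical
  refine ⟨hr.fix fun i rec => F (fun j => if h : r j i then rec j h else Classical.arbitrary α) i,
    fun i => ?_⟩
  rw [WellFounded.fix_eq]
  exact hF _ _ i fun j hj => dif_pos hj

theorem exists_perm_toList_pairwise_le {ι α : Type*} [Fintype ι] [LinearOrder α] (rank : ι → α) :
    ∃ l : List ι, l.Perm univ.toList ∧ l.Pairwise fun i j => rank i ≤ rank j := by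
  let r : ι → ι → Prop := fun i j => rank i ≤ rank j
  have : Std.Total r := ⟨fun i j => le_total (rank i) (rank j)⟩
  have : IsTrans ι r := ⟨fun _ _ _ => le_trans⟩
  exact ⟨_, List.perm_insertionSort r _, List.pairwise_insertionSort r _⟩

section ProductDistribution

variable {ι : Type*} [Fintype ι] [DecidableEq ι] {κ : ι → Type*}

theorem prod_update_mul {R : Type*} [CommSemiring R] (β : ∀ i, κ i → R) (s : ∀ i, κ i) (i : ι)
    (a : κ i) :
    (∏ k, β k (Function.update s i a k)) * β i (s i) = (∏ k, β k (s k)) * β i a := by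
  rw [← mul_prod_erase univ _ (mem_univ i), ← mul_prod_erase univ (fun k => β k (s k))
    (mem_univ i), Function.update_self, prod_congr rfl fun k hk => by
      rw [Function.update_of_ne (ne_of_mem_erase hk)]]
  ring

variable [∀ i, Fintype (κ i)]

theorem prod_mem_stdSimplex {R : Type*} [CommSemiring R] [PartialOrder R] [IsOrderedRing R]
    {β : ∀ i, κ i → R} (hβ : ∀ i, β i ∈ stdSimplex R (κ i)) :
    (fun s : ∀ i, κ i => ∏ i, β i (s i)) ∈ stdSimplex R (∀ i, κ i) := by
  refine ⟨fun s => prod_nonneg fun i _ => (hβ i).1 _, ?_⟩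
  rw [← Fintype.prod_sum]
  exact prod_eq_one fun i _ => (hβ i).2

theorem sum_prod_mul_mul_of_update_eq {R : Type*} [CommSemiring R] {β : ∀ i, κ i → R} {i : ι}
    (hβ : ∑ a, β i a = 1) (g : κ i → R) {f : (∀ i, κ i) → R}
    (hf : ∀ s a, f (Function.update s i a) = f s) :
    ∑ s, (∏ k, β k (s k)) * (g (s i) * f s) =
      (∑ a, β i a * g a) * ∑ s, (∏ k, β k (s k)) * f s := by
  -- Exchange the `i`-th coordinate with an independent copy of it.
  let swap : (∀ i, κ i) × κ i ≃ (∀ i, κ i) × κ i :=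
    { toFun := fun p => (Function.update p.1 i p.2, p.1 i)
      invFun := fun p => (Function.update p.1 i p.2, p.1 i)
      left_inv := fun p => by simp
      right_inv := fun p => by simp }
  calc ∑ s, (∏ k, β k (s k)) * (g (s i) * f s)
      = ∑ p : (∀ i, κ i) × κ i, (∏ k, β k (p.1 k)) * β i p.2 * (g (p.1 i) * f p.1) := by
        simp only [Fintype.sum_prod_type, ← sum_mul, ← mul_sum, hβ, mul_one]
    _ = ∑ p : (∀ i, κ i) × κ i, (∏ k, β k (p.1 k)) * β i p.2 * (g p.2 * f p.1) := by
        refine Fintype.sum_equiv swap _ _ fun p => ?_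
        simp only [swap, Equiv.coe_fn_mk, prod_update_mul, hf]
    _ = (∑ a, β i a * g a) * ∑ s, (∏ k, β k (s k)) * f s := by
        rw [sum_mul_sum, sum_comm, Fintype.sum_prod_type]
        exact Fintype.sum_congr _ _ fun s => Fintype.sum_congr _ _ fun a => by ring

end ProductDistribution

theorem exists_eq_sum_mul_of_nonneg {E : Type*} {G : Finset E} (hG : G.Nonempty) {z : E → ℝ}
    (hz : ∀ e ∈ G, 0 ≤ z e) :
    ∃ w : E → ℝ, (∀ e, 0 ≤ w e) ∧ (∀ e ∉ G, w e = 0) ∧ ∑ e ∈ G, w e = 1 ∧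
      ∀ e ∈ G, z e = (∑ e ∈ G, z e) * w e := by
  classical
  by_cases h : ∑ e ∈ G, z e = 0
  · obtain ⟨e₀, he₀⟩ := hG
    refine ⟨Pi.single e₀ 1, fun e => (Pi.single_nonneg.2 zero_le_one : (0 : E → ℝ) ≤ _) e,
      fun e he => Pi.single_eq_of_ne (ne_of_mem_of_not_mem he₀ he).symm _, ?_, fun e he => ?_⟩
    · rw [sum_pi_single', if_pos he₀]
    · rw [h, zero_mul]
      exact (sum_eq_zero_iff_of_nonneg hz).1 h e he
  · refine ⟨fun e => if e ∈ G then z e / ∑ e ∈ G, z e else 0, fun e => ?_,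
      fun e he => if_neg he, ?_, fun e he => ?_⟩
    · dsimp only
      split_ifs with he
      exacts [div_nonneg (hz e he) (sum_nonneg hz), le_rfl]
    · rw [sum_ite_mem, inter_self, ← sum_div, div_self h]
    · simp only [if_pos he, mul_div_cancel₀ _ h]

/- The Markov–Kakutani argument: the Birkhoff averages of an orbit accumulate at a fixed point. -/
theorem exists_mem_apply_eq_of_isCompact_of_convex {E : Type*} [NormedAddCommGroup E]
    [NormedSpace ℝ E] (f : E →L[ℝ] E) {K : Set E} (hK : IsCompact K) (hconv : Convex ℝ K)
    (hne : K.Nonempty) (hf : Set.MapsTo f K K) : ∃ x ∈ K, f x = x := by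
  obtain ⟨x₀, hx₀⟩ := hne
  have horbit : ∀ n, f^[n] x₀ ∈ K := fun n => hf.iterate n hx₀
  let y : ℕ → E := fun n => birkhoffAverage ℝ f id (n + 1) x₀
  have hy : ∀ n, y n ∈ K := fun n => by
    simp only [y, birkhoffAverage, birkhoffSum, id_eq, smul_sum]
    refine hconv.sum_mem (fun _ _ => by positivity) ?_ fun i _ => horbit i
    rw [sum_const, card_range, nsmul_eq_mul, mul_inv_cancel₀ (by positivity)]
  obtain ⟨x, hx, φ, hφ, hlim⟩ := hK.tendsto_subseq hy
  refine ⟨x, hx, sub_eq_zero.1 (tendsto_nhds_unique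
    (((f.continuous.tendsto x).comp hlim).sub hlim) ?_)⟩
  have hshift : ∀ n, f (y n) = birkhoffAverage ℝ f id (n + 1) (f x₀) := fun n => by
    rw [map_birkhoffAverage ℝ ℝ]
    simp only [birkhoffAverage, birkhoffSum, Function.comp_apply, id_eq,
      ← Function.iterate_succ_apply, Function.iterate_succ_apply']
  have hbounded : Bornology.IsBounded (Set.range fun n => id (f^[n] x₀)) :=
    hK.isBounded.subset (Set.range_subset_iff.2 horbit)
  have hzero := (tendsto_birkhoffAverage_apply_sub_birkhoffAverage ℝ hbounded).comp
    ((Filter.tendsto_add_atTop_nat 1).comp hφ.tendsto_atTop)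
  simpa only [Function.comp_def, hshift, y] using hzero

/-! ### Regret matching -/

section RegretMatching

variable {ι : Type u}

theorem history_succ (g : ℕ → ι → ℝ) (t : ℕ) : history g (t + 1) = history g t ++ [g t] := by
  rw [history, List.range_succ, List.map_append, List.map_singleton, history]

variable [Fintype ι]

theorem dotProduct_mem_Icc_of_mem_stdSimplex {g y : ι → ℝ} (hg : ∀ i, g i ∈ Set.Icc (0 : ℝ) 1)
    (hy : y ∈ stdSimplex ℝ ι) : g ⬝ᵥ y ∈ Set.Icc (0 : ℝ) 1 := by
  refine ⟨dotProduct_nonneg_of_nonneg (fun i => (hg i).1) hy.1, ?_⟩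
  rw [← hy.2]
  exact sum_le_sum fun i _ => mul_le_of_le_one_left (hy.1 i) (hg i).2

/-- The strategy that regret matching derives from a vector `r` of regrets: it is proportional to
the positive part of `r`, and uniform if no regret is positive. -/
noncomputable def regretStrategy (r : ι → ℝ) (i : ι) : ℝ :=
  if ∑ k, (r k)⁺ = 0 then (Fintype.card ι : ℝ)⁻¹ else (r i)⁺ / ∑ k, (r k)⁺

theorem regretStrategy_mem_stdSimplex [Nonempty ι] (r : ι → ℝ) :
    regretStrategy r ∈ stdSimplex ℝ ι := by
  constructor
  · intro i
    unfold regretStrategy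
    split_ifs
    exacts [by positivity, div_nonneg (posPart_nonneg _) (sum_nonneg fun _ _ => posPart_nonneg _)]
  · unfold regretStrategy
    split_ifs with h
    · simp
    · rw [← sum_div, div_self h]

theorem sum_posPart_mul_sub_dotProduct_regretStrategy (r g : ι → ℝ) :
    ∑ i, (r i)⁺ * (g i - g ⬝ᵥ regretStrategy r) = 0 := by
  by_cases h : ∑ k, (r k)⁺ = 0
  · have h0 := (sum_eq_zero_iff_of_nonneg fun k _ => posPart_nonneg (r k)).1 h
    exact sum_eq_zero fun i hi => by rw [h0 i hi, zero_mul]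
  · have hs : (∑ k, (r k)⁺) * (g ⬝ᵥ regretStrategy r) = ∑ i, (r i)⁺ * g i := by
      rw [dotProduct, mul_sum]
      refine Fintype.sum_congr _ _ fun i => ?_
      rw [regretStrategy, if_neg h]
      field_simp
    simp only [mul_sub, sum_sub_distrib, ← sum_mul, hs, sub_self]

/-- The regrets for not having played each single action while regret matching faced the utility
vectors in `l`. -/
noncomputable def cumulativeRegret (l : List (ι → ℝ)) : ι → ℝ :=
  l.foldl (fun r g i => r i + (g i - g ⬝ᵥ regretStrategy r)) 0

theorem cumulativeRegret_append_singleton (l : List (ι → ℝ)) (g : ι → ℝ) (i : ι) :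
    cumulativeRegret (l ++ [g]) i =
      cumulativeRegret l i + (g i - g ⬝ᵥ regretStrategy (cumulativeRegret l)) := by
  simp only [cumulativeRegret, List.foldl_append, List.foldl_cons, List.foldl_nil]

theorem posPart_add_sq_le (a b : ℝ) : (a + b)⁺ ^ 2 ≤ a⁺ ^ 2 + 2 * (a⁺ * b) + b ^ 2 := by
  have h : (a + b)⁺ ^ 2 ≤ (a⁺ + b) ^ 2 := by
    rcases le_total (a + b) 0 with h | h
    · rw [posPart_of_nonpos h, zero_pow two_ne_zero]
      exact sq_nonneg _
    · rw [posPart_of_nonneg h]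
      exact pow_le_pow_left₀ h (add_le_add_left (le_posPart a) b) 2
  linarith [add_sq a⁺ b]

theorem sum_posPart_cumulativeRegret_sq_le [Nonempty ι] {l : List (ι → ℝ)}
    (hl : ∀ g ∈ l, ∀ i, g i ∈ Set.Icc (0 : ℝ) 1) :
    ∑ i, (cumulativeRegret l i)⁺ ^ 2 ≤ Fintype.card ι * l.length := by
  induction l using List.reverseRecOn with
  | nil => simp [cumulativeRegret]
  | append_singleton l g ih =>
    have ih := ih fun g' hg' => hl g' (List.mem_append_left _ hg')
    have hg := hl g (by simp)
    set r := cumulativeRegret l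
    have hmean := dotProduct_mem_Icc_of_mem_stdSimplex hg (regretStrategy_mem_stdSimplex r)
    have hinst : ∀ i, (g i - g ⬝ᵥ regretStrategy r) ^ 2 ≤ 1 := fun i => by
      rw [sq_le_one_iff_abs_le_one, abs_le]
      constructor <;> linarith [(hg i).1, (hg i).2, hmean.1, hmean.2]
    simp only [cumulativeRegret_append_singleton]
    calc ∑ i, (r i + (g i - g ⬝ᵥ regretStrategy r))⁺ ^ 2
        ≤ ∑ i, ((r i)⁺ ^ 2 + 2 * ((r i)⁺ * (g i - g ⬝ᵥ regretStrategy r)) + 1) :=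
          sum_le_sum fun i _ => (posPart_add_sq_le _ _).trans (by gcongr; exact hinst i)
      _ = ∑ i, (r i)⁺ ^ 2 + Fintype.card ι := by
          rw [sum_add_distrib, sum_add_distrib, ← mul_sum,
            sum_posPart_mul_sub_dotProduct_regretStrategy]
          simp
      _ ≤ Fintype.card ι * l.length + Fintype.card ι := by gcongr
      _ = Fintype.card ι * (l ++ [g]).length := by
          rw [List.length_append, List.length_singleton]
          push_cast
          ring

/-- The online learner that plays the regret-matching strategy of its past regrets. -/
noncomputable def regretMatching (ι : Type u) [Fintype ι] [Nonempty ι] : LocalMinimizer ι where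
  next l := regretStrategy (cumulativeRegret l)
  next_mem _ := regretStrategy_mem_stdSimplex _

theorem sum_dotProduct_sub_regretMatching [Nonempty ι] (g : ℕ → ι → ℝ) {y : ι → ℝ}
    (hy : ∑ i, y i = 1) (T : ℕ) :
    ∑ t ∈ range T, g t ⬝ᵥ (y - (regretMatching ι).next (history g t)) =
      y ⬝ᵥ cumulativeRegret (history g T) := by
  induction T with
  | zero => simp [history, cumulativeRegret]
  | succ t ih =>
    rw [sum_range_succ, ih, history_succ]
    simp only [dotProduct, cumulativeRegret_append_singleton, mul_add, mul_sub, sum_add_distrib,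
      sum_sub_distrib, ← sum_mul, hy, one_mul, Pi.sub_apply,
      mul_comm (g t _), sub_mul]
    rfl

theorem hasRegret_regretMatching [Nonempty ι] :
    (regretMatching ι).HasRegret fun T => √(Fintype.card ι * T) := by
  intro g hg T y hy
  have hregret : ∀ i, cumulativeRegret (history g T) i ≤ √(Fintype.card ι * T) := fun i => by
    refine (le_posPart _).trans (Real.le_sqrt_of_sq_le ?_)
    calc (cumulativeRegret (history g T) i)⁺ ^ 2
        ≤ ∑ i, (cumulativeRegret (history g T) i)⁺ ^ 2 :=
          single_le_sum (f := fun i => (cumulativeRegret (history g T) i)⁺ ^ 2)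
            (fun _ _ => sq_nonneg _) (mem_univ i)
      _ ≤ Fintype.card ι * (history g T).length :=
          sum_posPart_cumulativeRegret_sq_le (by simpa [history] using fun t _ => hg t)
      _ = Fintype.card ι * T := by simp [history]
  calc ∑ t ∈ range T, g t ⬝ᵥ (y - (regretMatching ι).next (history g t))
      = ∑ i, y i * cumulativeRegret (history g T) i := sum_dotProduct_sub_regretMatching g hy.2 T
    _ ≤ ∑ i, y i * √(Fintype.card ι * T) :=
        sum_le_sum fun i _ => mul_le_mul_of_nonneg_left (hregret i) (hy.1 i)
    _ = √(Fintype.card ι * T) := by rw [← sum_mul, hy.2, one_mul]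

theorem LocalMinimizer.HasRegret.mono {R : LocalMinimizer ι} {ρ ρ' : ℕ → ℝ} (h : R.HasRegret ρ)
    (hρ : ρ ≤ ρ') : R.HasRegret ρ' :=
  fun g hg T y hy => (h g hg T y hy).trans (hρ T)

theorem LocalMinimizer.HasRegret.nonneg {R : LocalMinimizer ι} {ρ : ℕ → ℝ} (h : R.HasRegret ρ)
    (T : ℕ) : 0 ≤ ρ T := by
  simpa using h (fun _ _ => 0) (fun _ _ => by simp) T _ (R.next_mem [])

theorem exists_localMinimizer_hasRegret (ι : Type u) [Fintype ι] [Nonempty ι] :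
    ∃ R : LocalMinimizer ι, R.HasRegret fun T => (Fintype.card ι : ℝ) * √T :=
  ⟨regretMatching ι, hasRegret_regretMatching.mono fun T => by
    have hcard : (1 : ℝ) ≤ Fintype.card ι := by exact_mod_cast Fintype.card_pos
    dsimp only
    rw [Real.sqrt_mul (Nat.cast_nonneg _)]
    gcongr
    exact Real.sqrt_le_self_iff.2 (Or.inr hcard)⟩

end RegretMatching

/-! ### The tree of sequences -/

namespace TreeFormDecisionProblem

section Tree

variable (P : TreeFormDecisionProblem.{u})

/-- The number of decision points above `j`. -/
noncomputable def depth : P.Dec → ℕ :=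
  P.wf.fix fun j rec =>
    match h : P.parent j with
    | none => 0
    | some ⟨i, a⟩ => rec i ⟨a, h⟩ + 1

/-- The number of decision points above the sequence `σ`. -/
noncomputable def seqDepth : P.Seq → ℕ
  | none => 0
  | some ⟨j, _⟩ => P.depth j + 1

@[simp]
theorem seqDepth_parent (j : P.Dec) : P.seqDepth (P.parent j) = P.depth j := by
  rw [depth, WellFounded.fix_eq]
  split
  · next h => rw [h]; rfl
  · next i a h => exact (congrArg P.seqDepth h).trans rfl

variable {P}

@[simp]
theorem seqDepth_child (j : P.Dec) (a : P.Act j) : P.seqDepth (P.child j a) = P.depth j + 1 := rfl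

theorem depth_lt_depth_of_parent_eq_child {j k : P.Dec} {a : P.Act j}
    (h : P.parent k = P.child j a) : P.depth j < P.depth k := by
  rw [← P.seqDepth_parent k, h, seqDepth_child]
  exact Nat.lt_succ_self _

theorem seq_induction {p : P.Seq → Prop} (root : p P.root)
    (child : ∀ j, p (P.parent j) → ∀ a, p (P.child j a)) (σ : P.Seq) : p σ := by
  have hparent : ∀ j, p (P.parent j) := fun j => by
    induction j using P.wf.induction with
    | _ j ih =>
      match h : P.parent j with
      | none => exact root
      | some ⟨i, a⟩ => exact child i (ih i ⟨a, h⟩) a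
  rcases σ with _ | ⟨j, a⟩
  · exact root
  · exact child j (hparent j) a

theorem dec_induction {p : P.Dec → Prop}
    (step : ∀ j, (∀ a, ∀ k : P.Next (P.child j a), p k.1) → p j) (j : P.Dec) : p j := by
  induction j using (wellFounded_apply_gt P.depth).induction with
  | _ j ih => exact step j fun a k => ih k.1 (depth_lt_depth_of_parent_eq_child k.2)

theorem sum_seq {M : Type*} [AddCommMonoid M] (f : P.Seq → M) :
    ∑ σ, f σ = f P.root + ∑ j, ∑ a, f (P.child j a) := by
  rw [Fintype.sum_option, Fintype.sum_sigma]

theorem sum_next {M : Type*} [AddCommMonoid M] (f : P.Seq → P.Dec → M) :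
    ∑ σ, ∑ k : P.Next σ, f σ k.1 = ∑ k, f (P.parent k) k := by
  rw [← Fintype.sum_sigma' (fun σ (k : P.Next σ) => f σ k.1),
    ← (Equiv.sigmaFiberEquiv P.parent).sum_comp]
  refine Fintype.sum_congr _ _ ?_
  rintro ⟨σ, k, rfl⟩
  rfl

theorem sum_card_act : ∑ j, Fintype.card (P.Act j) + 1 = P.size := by
  rw [size, Fintype.card_option, Fintype.card_sigma]

theorem sum_card_next : ∑ σ, Fintype.card (P.Next σ) = Fintype.card P.Dec := by
  simpa only [sum_const, card_univ, smul_eq_mul, mul_one] using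
    sum_next (P := P) (fun _ _ => (1 : ℕ))

theorem card_dec_lt_size : Fintype.card P.Dec < P.size := by
  rw [← sum_card_act, Nat.lt_succ_iff, ← card_univ, card_eq_sum_ones]
  exact sum_le_sum fun j _ => Fintype.card_pos

theorem sum_card_choice_le : ∑ v : P.UDec, Fintype.card (P.Choice v) ≤ 2 * P.size ^ 2 := by
  have hcard : ∑ v : P.UDec, Fintype.card (P.Choice v) =
      P.size * (∑ j, Fintype.card (P.Act j)) + Fintype.card P.Dec * Fintype.card P.Dec := by
    calc ∑ v : P.UDec, Fintype.card (P.Choice v)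
        = ∑ j, ∑ τ, (Fintype.card (P.Act j) + Fintype.card (P.Next τ)) := by
          simp only [Fintype.card_sum, Fintype.sum_prod_type]
      _ = P.size * (∑ j, Fintype.card (P.Act j)) + Fintype.card P.Dec * Fintype.card P.Dec := by
          simp only [sum_add_distrib, sum_card_next, sum_const, card_univ, smul_eq_mul, mul_sum,
            size]
  have hdec := card_dec_lt_size (P := P)
  have hact := sum_card_act (P := P)
  rw [hcard]
  nlinarith

end Tree

/-! ### The sequence form -/

section SequenceForm

variable {P : TreeFormDecisionProblem.{u}}

/-- The linear constraints of sequence-form strategies. -/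
structure IsFlow (x : P.Seq → ℝ) : Prop where
  root : x P.root = 1
  nonneg : ∀ σ, 0 ≤ x σ
  sum_child : ∀ k, ∑ a, x (P.child k a) = x (P.parent k)

theorem selected_child {plan : ∀ j, P.Act j} {j : P.Dec} {a : P.Act j} :
    Selected plan (P.child j a) ↔ plan j = a ∧ Selected plan (P.parent j) := by
  constructor
  · rintro (_ | ⟨_, h⟩)
    exact ⟨rfl, h⟩
  · rintro ⟨rfl, h⟩
    exact .step j h

theorem Selected.congr {plan plan' : ∀ j, P.Act j} {σ : P.Seq} (h : Selected plan σ)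
    (heq : ∀ i, P.depth i < P.seqDepth σ → plan i = plan' i) : Selected plan' σ := by
  induction h with
  | root => exact .root
  | step j _ ih =>
    rw [heq j (Nat.lt_succ_self _)]
    exact .step j (ih fun i hi => heq i ((hi.trans_eq (P.seqDepth_parent j)).trans_le
      (Nat.le_succ _)))

theorem exists_plan_selected (σ : P.Seq) : ∃ plan : ∀ j, P.Act j, Selected plan σ := by
  induction σ using seq_induction with
  | root => exact ⟨fun _ => Classical.arbitrary _, .root⟩
  | child j ih a =>
    obtain ⟨plan, hplan⟩ := ih
    refine ⟨Function.update plan j a, selected_child.2 ⟨Function.update_self ..,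
      hplan.congr fun i hi => (Function.update_of_ne ?_ ..).symm⟩⟩
    rintro rfl
    exact hi.ne' (P.seqDepth_parent i)

theorem pureVector_root (plan : ∀ j, P.Act j) : P.pureVector plan P.root = 1 :=
  if_pos .root

theorem pureVector_child (plan : ∀ j, P.Act j) (j : P.Dec) (a : P.Act j) :
    P.pureVector plan (P.child j a) = if plan j = a then P.pureVector plan (P.parent j) else 0 := by
  by_cases h : plan j = a <;> by_cases h' : Selected plan (P.parent j) <;>
    simp [pureVector, selected_child, h, h']

theorem pureVector_zero_or_one (plan : ∀ j, P.Act j) (σ : P.Seq) :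
    P.pureVector plan σ = 0 ∨ P.pureVector plan σ = 1 :=
  by classical exact (ite_eq_or_eq _ _ _).symm

theorem isFlow_pureVector (plan : ∀ j, P.Act j) : IsFlow (P.pureVector plan) where
  root := pureVector_root plan
  nonneg σ := by rcases pureVector_zero_or_one plan σ with h | h <;> simp [h]
  sum_child k := by simp [pureVector_child]

theorem convex_setOf_isFlow : Convex ℝ {x : P.Seq → ℝ | IsFlow x} := by
  intro x hx y hy a b ha hb hab
  refine ⟨?_, fun σ => ?_, fun k => ?_⟩
  · simp [hx.root, hy.root, hab]
  · exact add_nonneg (mul_nonneg ha (hx.nonneg σ)) (mul_nonneg hb (hy.nonneg σ))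
  · simp only [Pi.add_apply, Pi.smul_apply, smul_eq_mul, sum_add_distrib, ← mul_sum, hx.sum_child,
      hy.sum_child]

theorem isFlow_of_mem_X {x : P.Seq → ℝ} (hx : x ∈ P.X) : IsFlow x := by
  obtain ⟨plan, rfl⟩ := hx
  exact isFlow_pureVector plan

theorem isFlow_of_mem_coX {x : P.Seq → ℝ} (hx : x ∈ P.coX) : IsFlow x :=
  convexHull_min (fun _ => isFlow_of_mem_X) convex_setOf_isFlow hx

namespace IsFlow

variable {x : P.Seq → ℝ}

theorem child_le (hx : IsFlow x) (j : P.Dec) (a : P.Act j) : x (P.child j a) ≤ x (P.parent j) := by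
  rw [← hx.sum_child]
  exact single_le_sum (f := fun a => x (P.child j a)) (fun _ _ => hx.nonneg _) (mem_univ a)

theorem le_one (hx : IsFlow x) (σ : P.Seq) : x σ ≤ 1 := by
  induction σ using seq_induction with
  | root => exact hx.root.le
  | child j ih a => exact (hx.child_le j a).trans ih

theorem exists_forall_child_eq (hx : IsFlow x) (h01 : ∀ σ, x σ = 0 ∨ x σ = 1) (j : P.Dec) :
    ∃ a, ∀ b, x (P.child j b) = if a = b then x (P.parent j) else 0 := by
  obtain ⟨a, ha⟩ : ∃ a, x (P.child j a) = x (P.parent j) := by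
    rcases h01 (P.parent j) with h | h
    · exact ⟨Classical.arbitrary _, le_antisymm (hx.child_le j _) (h.trans_le (hx.nonneg _))⟩
    · by_contra! hne
      refine one_ne_zero (h.symm.trans ((hx.sum_child j).symm.trans (sum_eq_zero fun a _ => ?_)))
      exact (h01 _).resolve_right fun ha => hne a (ha.trans h.symm)
  refine ⟨a, fun b => ?_⟩
  split_ifs with hab
  · rw [← hab, ha]
  · have hsum := add_le_sum (f := fun a => x (P.child j a)) (fun _ _ => hx.nonneg _) (mem_univ a)
      (mem_univ b) hab
    rw [hx.sum_child, ha] at hsum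
    exact le_antisymm (by linarith) (hx.nonneg _)

theorem mem_X (hx : IsFlow x) (h01 : ∀ σ, x σ = 0 ∨ x σ = 1) : x ∈ P.X := by
  choose plan hplan using hx.exists_forall_child_eq h01
  refine ⟨plan, funext fun σ => ?_⟩
  induction σ using seq_induction with
  | root => rw [pureVector_root, hx.root]
  | child j ih a => rw [pureVector_child, hplan, ih]

end IsFlow

end SequenceForm

/-! ### Reduced costs -/

section ReducedCosts

variable {P : TreeFormDecisionProblem.{u}}

/-- The value of `b` at the decision point that precedes a sequence, and `0` at the root. -/
def before (b : P.Dec → ℝ) : P.Seq → ℝ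
  | none => 0
  | some ⟨k, _⟩ => b k

@[simp]
theorem before_root (b : P.Dec → ℝ) : before b P.root = 0 := rfl

@[simp]
theorem before_child (b : P.Dec → ℝ) (k : P.Dec) (a : P.Act k) : before b (P.child k a) = b k := rfl

theorem sum_before_mul {x : P.Seq → ℝ} (hx : IsFlow x) (b : P.Dec → ℝ) :
    ∑ σ, before b σ * x σ = ∑ σ, (∑ k : P.Next σ, b k.1) * x σ := by
  have hnext : ∑ σ, (∑ k : P.Next σ, b k.1) * x σ = ∑ k, b k * x (P.parent k) := by
    simp only [sum_mul]
    exact sum_next fun σ k => b k * x σ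
  rw [hnext, sum_seq]
  simp only [before_root, zero_mul, zero_add, before_child, ← mul_sum, hx.sum_child]

/-- The costs on sequences that arise from a potential `b` on the decision points, by moving the
cost `b k` from all children of `k` to the parent of `k`.  They vanish on every strategy. -/
def shift : (P.Dec → ℝ) →ₗ[ℝ] P.Seq → ℝ where
  toFun b σ := ∑ k : P.Next σ, b k.1 - before b σ
  map_add' b b' := by
    funext σ
    rcases σ with _ | ⟨k, a⟩ <;> simp [before, sum_add_distrib, add_sub_add_comm]
  map_smul' r b := by
    funext σ
    rcases σ with _ | ⟨k, a⟩ <;> simp [before, mul_sum, mul_sub]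

theorem shift_apply (b : P.Dec → ℝ) (σ : P.Seq) :
    shift b σ = ∑ k : P.Next σ, b k.1 - before b σ := rfl

theorem shift_dotProduct {x : P.Seq → ℝ} (hx : IsFlow x) (b : P.Dec → ℝ) : shift b ⬝ᵥ x = 0 := by
  simp only [dotProduct, shift_apply, sub_mul, sum_sub_distrib, sum_before_mul hx, sub_self]

theorem add_shift_dotProduct {x : P.Seq → ℝ} (hx : IsFlow x) (c : P.Seq → ℝ) (b : P.Dec → ℝ) :
    (c + shift b) ⬝ᵥ x = c ⬝ᵥ x := by
  rw [add_dotProduct, shift_dotProduct hx, add_zero]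

/-- Costs on sequences as they are left by dynamic programming: they are nonnegative below the root,
and some action at every decision point has cost zero. -/
def IsReduced (c : P.Seq → ℝ) : Prop :=
  ∀ k, (∀ a, 0 ≤ c (P.child k a)) ∧ ∃ a, c (P.child k a) = 0

theorem exists_isReduced_add_shift (c : P.Seq → ℝ) : ∃ b, IsReduced (c + shift b) := by
  -- Dynamic programming: `b k` is the least cost that can be achieved from `k` on.
  obtain ⟨b, hb⟩ := exists_forall_eq_of_wellFounded (wellFounded_apply_gt P.depth)
    (fun (b : P.Dec → ℝ) k => univ.inf' univ_nonempty fun a => c (P.child k a) +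
      ∑ i : P.Next (P.child k a), b i.1) fun f g k h =>
    inf'_congr _ rfl fun a _ => congrArg (c (P.child k a) + ·) <| Fintype.sum_congr _ _ fun i =>
      h _ (depth_lt_depth_of_parent_eq_child i.2)
  refine ⟨b, fun k => ⟨fun a => ?_, ?_⟩⟩
  · have hle : b k ≤ c (P.child k a) + ∑ i : P.Next (P.child k a), b i.1 := by
      rw [hb k]
      exact inf'_le _ (mem_univ a)
    rwa [Pi.add_apply, shift_apply, before_child, ← add_sub_assoc, sub_nonneg]
  · obtain ⟨a, -, ha⟩ := exists_mem_eq_inf' (univ_nonempty (α := P.Act k)) fun a =>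
      c (P.child k a) + ∑ i : P.Next (P.child k a), b i.1
    refine ⟨a, ?_⟩
    rw [Pi.add_apply, shift_apply, before_child, ← add_sub_assoc, ← ha, ← hb k, sub_self]

theorem nonneg_of_isReduced_add_shift {c : P.Seq → ℝ} {b : P.Dec → ℝ}
    (hc : ∀ j a, 0 ≤ c (P.child j a)) (hb : IsReduced (c + shift b)) (k : P.Dec) : 0 ≤ b k := by
  induction k using dec_induction with
  | step j ih =>
    obtain ⟨a, ha⟩ := (hb j).2
    have hsum := sum_nonneg fun k (_ : k ∈ univ) => ih a k
    rw [Pi.add_apply, shift_apply, before_child] at ha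
    linarith [hc j a]

namespace IsReduced

variable {c c' : P.Seq → ℝ}

theorem exists_dotProduct_eq (hc : IsReduced c) : ∃ x ∈ P.X, c ⬝ᵥ x = c P.root := by
  choose plan hplan using fun k => (hc k).2
  refine ⟨_, ⟨plan, rfl⟩, ?_⟩
  rw [dotProduct, sum_seq, pureVector_root, mul_one, add_eq_left]
  refine sum_eq_zero fun j _ => sum_eq_zero fun a _ => ?_
  rw [pureVector_child]
  split_ifs with h
  · rw [← h, hplan, zero_mul]
  · rw [mul_zero]

theorem nonneg (hc : IsReduced c) (h : ∀ x ∈ P.X, 0 ≤ c ⬝ᵥ x) (σ : P.Seq) : 0 ≤ c σ := by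
  rcases σ with _ | ⟨j, a⟩
  · obtain ⟨x, hx, hcx⟩ := hc.exists_dotProduct_eq
    exact hcx ▸ h x hx
  · exact (hc j).1 a

theorem eq_zero (hc : IsReduced c) (h : ∀ x ∈ P.X, c ⬝ᵥ x = 0) : c = 0 := by
  funext σ
  obtain ⟨plan, hplan⟩ := exists_plan_selected σ
  have hnonneg := hc.nonneg fun x hx => (h x hx).ge
  have hterm := (sum_eq_zero_iff_of_nonneg fun τ _ => mul_nonneg (hnonneg τ)
    ((isFlow_pureVector plan).nonneg τ)).1 (h _ ⟨plan, rfl⟩) σ (mem_univ _)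
  rwa [pureVector, if_pos hplan, mul_one] at hterm

/- The costs differ by a shift, and both the potential of this shift and its negative are
nonnegative. -/
theorem eq (hc : IsReduced c) (hc' : IsReduced c') (h : ∀ x ∈ P.X, c ⬝ᵥ x = c' ⬝ᵥ x) : c = c' := by
  obtain ⟨b, hb⟩ := exists_isReduced_add_shift (c - c')
  have hzero : c - c' + shift b = 0 := hb.eq_zero fun x hx => by
    rw [add_shift_dotProduct (isFlow_of_mem_X hx), sub_dotProduct, h x hx, sub_self]
  have hc'_eq : c' = c + shift b := by
    rw [← sub_eq_zero, ← neg_eq_zero, ← hzero]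
    abel
  have hc_eq : c = c' + shift (-b) := by rw [hc'_eq, map_neg, add_neg_cancel_right]
  have hb0 : b = 0 := funext fun k => le_antisymm
    (neg_nonneg.1 (nonneg_of_isReduced_add_shift (fun j a => (hc' j).1 a) (hc_eq ▸ hc) k))
    (nonneg_of_isReduced_add_shift (fun j a => (hc j).1 a) (hc'_eq ▸ hc') k)
  rw [hc'_eq, hb0, map_zero, add_zero]

theorem exists_nonneg_eq_add_shift (hc : IsReduced c) (hc' : ∀ j a, 0 ≤ c' (P.child j a))
    (h : ∀ x ∈ P.X, c ⬝ᵥ x = c' ⬝ᵥ x) : ∃ b, (∀ k, 0 ≤ b k) ∧ c = c' + shift b := by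
  obtain ⟨b, hb⟩ := exists_isReduced_add_shift c'
  refine ⟨b, nonneg_of_isReduced_add_shift hc' hb, hc.eq hb fun x hx => ?_⟩
  rw [add_shift_dotProduct (isFlow_of_mem_X hx), h x hx]

end IsReduced

theorem exists_isReduced_nonneg_dotProduct_eq {c : P.Seq → ℝ} (h : ∀ x ∈ P.X, 0 ≤ c ⬝ᵥ x) :
    ∃ c', IsReduced c' ∧ (∀ σ, 0 ≤ c' σ) ∧ ∀ x ∈ P.X, c' ⬝ᵥ x = c ⬝ᵥ x := by
  obtain ⟨b, hb⟩ := exists_isReduced_add_shift c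
  have hdot : ∀ x ∈ P.X, (c + shift b) ⬝ᵥ x = c ⬝ᵥ x := fun x hx =>
    add_shift_dotProduct (isFlow_of_mem_X hx) c b
  exact ⟨_, hb, hb.nonneg fun x hx => (h x hx).trans_eq (hdot x hx).symm, hdot⟩

end ReducedCosts

end TreeFormDecisionProblem

/-! ### Coordinates of the UTC polytope -/

namespace TreeFormDecisionProblem

section Coordinates

variable {P : TreeFormDecisionProblem.{u}}

theorem arrival_eq_add_before (z : P.Coord → ℝ) (j : P.Dec) (τ : P.Seq) :
    arrival (j, τ) z = z (.inl (P.parent j, τ)) + before (fun k => z (.inr (j, k))) τ := by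
  rcases τ with _ | ⟨k, a⟩ <;> rfl

theorem isLinearMap_arrival (v : P.UDec) : IsLinearMap ℝ (arrival (P := P) v) := by
  obtain ⟨j, _ | ⟨k, a⟩⟩ := v <;> constructor <;> intros <;> simp [arrival, queryMass] <;> ring

theorem arrival_sum_smul {ι : Type*} [Fintype ι] (v : P.UDec) (μ : ι → ℝ) (Z : ι → P.Coord → ℝ) :
    arrival v (∑ s, μ s • Z s) = ∑ s, μ s * arrival v (Z s) := by
  have := map_sum (isLinearMap_arrival v).mk' (fun s => μ s • Z s) univ
  simpa only [map_smul, smul_eq_mul, IsLinearMap.mk'_apply] using this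

/-- The coordinate `e` contributes to the mass that arrives at `v`. -/
inductive Feeds : P.Coord → P.UDec → Prop
  | observe (j : P.Dec) (τ : P.Seq) : Feeds (.inl (P.parent j, τ)) (j, τ)
  | reply (j k : P.Dec) (a : P.Act k) : Feeds (.inr (j, k)) (j, P.child k a)

theorem arrival_congr {z z' : P.Coord → ℝ} {v : P.UDec} (h : ∀ e, Feeds e v → z e = z' e) :
    arrival v z = arrival v z' := by
  obtain ⟨j, _ | ⟨k, a⟩⟩ := v
  · simp only [arrival, queryMass, h _ (.observe j _)]
  · simp only [arrival, queryMass, h _ (.observe j _), h _ (.reply j k a)]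

theorem arrival_nonneg {z : P.Coord → ℝ} {v : P.UDec} (h : ∀ e, Feeds e v → 0 ≤ z e) :
    0 ≤ arrival v z := by
  obtain ⟨j, _ | ⟨k, a⟩⟩ := v
  · exact add_nonneg (h _ (.observe j _)) le_rfl
  · exact add_nonneg (h _ (.observe j _)) (h _ (.reply j k a))

theorem Feeds.le_arrival {z : P.Coord → ℝ} (hz : ∀ e, 0 ≤ z e) {e : P.Coord} {v : P.UDec}
    (he : Feeds e v) : z e ≤ arrival v z := by
  cases he with
  | observe j τ =>
    rcases τ with _ | ⟨k, a⟩
    exacts [le_add_of_nonneg_right le_rfl, le_add_of_nonneg_right (hz _)]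
  | reply j k a => exact le_add_of_nonneg_left (hz _)

theorem exists_feeds_ne_zero {z : P.Coord → ℝ} {v : P.UDec} (h : arrival v z ≠ 0) :
    ∃ e, Feeds e v ∧ z e ≠ 0 := by
  by_contra! hzero
  exact h ((arrival_congr hzero).trans (isLinearMap_arrival v).map_zero)

variable (P) in
/-- The number of choices made before a decision point of the UTC problem is reached. -/
noncomputable def decDepth (v : P.UDec) : ℕ := P.depth v.1 + P.seqDepth v.2

variable (P) in
/-- The number of choices made before a node that carries a coordinate is reached. -/
noncomputable def coordDepth : P.Coord → ℕ
  | .inl (σ, τ) => P.seqDepth σ + P.seqDepth τ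
  | .inr (j, k) => P.depth j + P.depth k + 1

theorem Feeds.coordDepth_eq {e : P.Coord} {v : P.UDec} (h : Feeds e v) :
    P.coordDepth e = P.decDepth v := by
  cases h with
  | observe j τ => simp only [coordDepth, decDepth, seqDepth_parent]
  | reply j k a => simp only [coordDepth, decDepth, seqDepth_child, add_assoc]

theorem coordDepth_choiceCoord (v : P.UDec) (i : P.Choice v) :
    P.coordDepth (choiceCoord v i) = P.decDepth v + 1 := by
  obtain ⟨j, τ⟩ := v
  rcases i with a | ⟨k, (rfl : P.parent k = τ)⟩
  · simp only [choiceCoord, coordDepth, decDepth, seqDepth_child]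
    omega
  · simp only [choiceCoord, coordDepth, decDepth, seqDepth_parent]

theorem Feeds.coordDepth_lt {e : P.Coord} {v : P.UDec} (h : Feeds e v) (i : P.Choice v) :
    P.coordDepth e < P.coordDepth (choiceCoord v i) := by
  rw [h.coordDepth_eq, coordDepth_choiceCoord]
  exact Nat.lt_succ_self _

theorem eq_root_or_exists_choiceCoord (e : P.Coord) :
    (∃ τ, e = .inl (P.root, τ)) ∨ ∃ v i, choiceCoord v i = e := by
  rcases e with ⟨_ | ⟨j, a⟩, τ⟩ | ⟨j, k⟩
  · exact .inl ⟨τ, rfl⟩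
  · exact .inr ⟨(j, τ), .inl a, rfl⟩
  · exact .inr ⟨(j, P.parent k), .inr ⟨k, rfl⟩, rfl⟩

theorem choiceCoord_ne_root (v : P.UDec) (i : P.Choice v) (τ : P.Seq) :
    choiceCoord v i ≠ .inl (P.root, τ) := by
  rcases i with a | k <;> simp [choiceCoord]

theorem sigma_choiceCoord_injective :
    Function.Injective fun p : Σ v : P.UDec, P.Choice v => choiceCoord p.1 p.2 := by
  rintro ⟨⟨j, τ⟩, a | ⟨k, (rfl : P.parent k = τ)⟩⟩ ⟨⟨j', τ'⟩, a' | ⟨k', (rfl : P.parent k' = τ')⟩⟩ h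
  all_goals cases h
  all_goals rfl

theorem coord_induction {p : P.Coord → Prop} (root : ∀ τ, p (.inl (P.root, τ)))
    (choice : ∀ v, (∀ e, Feeds e v → p e) → ∀ i, p (choiceCoord v i)) (e : P.Coord) : p e := by
  induction e using (measure P.coordDepth).wf.induction with
  | _ e ih =>
    obtain ⟨τ, rfl⟩ | ⟨v, i, rfl⟩ := eq_root_or_exists_choiceCoord e
    · exact root τ
    · exact choice v (fun e he => ih e (he.coordDepth_lt i)) i

end Coordinates

/-! ### Points of the UTC polytope act on strategies -/

section Polytope

variable {P : TreeFormDecisionProblem.{u}}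

theorem forall_arrival_eq_iff (z : P.Coord → ℝ) (j : P.Dec) :
    (∀ τ, arrival (j, τ) z = ∑ i, z (choiceCoord (j, τ) i)) ↔
      devMatrix z (P.parent j) =
        ∑ a, devMatrix z (P.child j a) + shift fun k => z (.inr (j, k)) := by
  rw [funext_iff]
  refine forall_congr' fun τ => ?_
  rw [arrival_eq_add_before, Fintype.sum_sum_type, ← eq_sub_iff_add_eq, add_sub_assoc,
    Pi.add_apply, Finset.sum_apply, shift_apply]
  rfl

theorem rootPoint_inl_root (τ : P.Seq) :
    P.rootPoint (.inl (P.root, τ)) = if τ = P.root then 1 else 0 := by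
  simp [rootPoint, Pi.single_apply]

section MemUTCPolytope

variable {z : P.Coord → ℝ}

theorem apply_root_of_mem_utcPolytope (hz : z ∈ P.utcPolytope) (τ : P.Seq) :
    z (.inl (P.root, τ)) = P.rootPoint (.inl (P.root, τ)) := by
  rw [rootPoint_inl_root]
  split_ifs with h
  exacts [h ▸ hz.2.1, hz.2.2.1 τ h]

theorem isFlow_mulVec_of_mem_utcPolytope (hz : z ∈ P.utcPolytope) {x : P.Seq → ℝ} (hx : IsFlow x) :
    IsFlow ((devMatrix z).mulVec x) where
  root := by
    simp [Matrix.mulVec, dotProduct, devMatrix, apply_root_of_mem_utcPolytope hz,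
      rootPoint_inl_root, hx.root]
  nonneg σ := sum_nonneg fun τ _ => mul_nonneg (hz.2.2.2 _) (hx.nonneg τ)
  sum_child j := by
    simp only [Matrix.mulVec]
    rw [(forall_arrival_eq_iff z j).1 fun τ => hz.1 (j, τ), add_shift_dotProduct hx,
      sum_dotProduct]

theorem choice_le_arrival_of_mem_utcPolytope (hz : z ∈ P.utcPolytope) (v : P.UDec)
    (i : P.Choice v) :
    z (choiceCoord v i) ≤ arrival v z := by
  rw [hz.1 v]
  exact single_le_sum (f := fun i => z (choiceCoord v i)) (fun _ _ => hz.2.2.2 _) (mem_univ i)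

open Classical in
/- Unfolding the mass that has been queried along the path of the mediator to `τ`. -/
theorem arrival_le_sum_of_selected (hz : z ∈ P.utcPolytope) {plan : ∀ j, P.Act j}
    (j : P.Dec) {τ : P.Seq} (hτ : Selected plan τ) :
    arrival (j, τ) z ≤ ∑ τ' with Selected plan τ' ∧ P.seqDepth τ' ≤ P.seqDepth τ,
      z (.inl (P.parent j, τ')) := by
  induction hτ with
  | root =>
    rw [arrival_eq_add_before, before_root, add_zero]
    exact single_le_sum (f := fun τ' => z (.inl (P.parent j, τ'))) (fun _ _ => hz.2.2.2 _)
      (mem_filter.2 ⟨mem_univ _, .root, le_rfl⟩)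
  | step k hk ih =>
    rw [arrival_eq_add_before, before_child]
    refine (add_le_add_right ((choice_le_arrival_of_mem_utcPolytope hz (j, P.parent k)
      (.inr ⟨k, rfl⟩)).trans ih) _).trans ?_
    rw [← sum_insert (f := fun τ' => z (.inl (P.parent j, τ')))]
    · refine sum_le_sum_of_subset_of_nonneg (fun τ' hτ' => ?_) fun _ _ _ => hz.2.2.2 _
      rcases mem_insert.1 hτ' with rfl | hτ'
      · exact (mem_filter_univ _).2 ⟨.step k hk, le_rfl⟩
      · obtain ⟨hsel, hdepth⟩ := (mem_filter_univ _).1 hτ'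
        rw [seqDepth_parent] at hdepth
        exact (mem_filter_univ _).2 ⟨hsel, hdepth.trans ((Nat.le_succ _).trans (by simp))⟩
    · simp

theorem arrival_le_one_of_mem_utcPolytope (hz : z ∈ P.utcPolytope) (v : P.UDec) :
    arrival v z ≤ 1 := by
  classical
  obtain ⟨j, τ⟩ := v
  obtain ⟨plan, hplan⟩ := exists_plan_selected τ
  have hflow := isFlow_pureVector plan
  calc arrival (j, τ) z
      ≤ ∑ τ' with Selected plan τ' ∧ P.seqDepth τ' ≤ P.seqDepth τ, z (.inl (P.parent j, τ')) :=
        arrival_le_sum_of_selected hz j hplan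
    _ = ∑ τ' with Selected plan τ' ∧ P.seqDepth τ' ≤ P.seqDepth τ,
          z (.inl (P.parent j, τ')) * P.pureVector plan τ' :=
        sum_congr rfl fun τ' hτ' => by
          rw [pureVector, if_pos (mem_filter.1 hτ').2.1, mul_one]
    _ ≤ (devMatrix z).mulVec (P.pureVector plan) (P.parent j) :=
        sum_le_univ_sum_of_nonneg fun τ' => mul_nonneg (hz.2.2.2 _) (hflow.nonneg τ')
    _ ≤ 1 := (isFlow_mulVec_of_mem_utcPolytope hz hflow).le_one _

end MemUTCPolytope

theorem exists_isReduced_rows {φ : P.Deviation} (hφ : φ ∈ P.linearDeviations) :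
    ∃ A : P.Seq → P.Seq → ℝ, (∀ σ, IsReduced (A σ)) ∧ (∀ σ τ, 0 ≤ A σ τ) ∧
      ∀ σ (x : P.X), A σ ⬝ᵥ (x : P.Seq → ℝ) = φ x σ := by
  obtain ⟨hmem, L, hL⟩ := hφ
  have hrow : ∀ σ (x : P.X), LinearMap.toMatrix' L σ ⬝ᵥ (x : P.Seq → ℝ) = φ x σ := fun σ x =>
    (congrFun (LinearMap.toMatrix'_mulVec L x) σ).trans (congrFun (hL x) σ).symm
  choose A hred hnonneg hdot using fun σ => exists_isReduced_nonneg_dotProduct_eq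
    (c := LinearMap.toMatrix' L σ) fun x hx =>
      ((isFlow_of_mem_coX (hmem ⟨x, hx⟩)).nonneg σ).trans_eq (hrow σ ⟨x, hx⟩).symm
  exact ⟨A, hred, hnonneg, fun σ x => (hdot σ x x.2).trans (hrow σ x)⟩

/- The rows of the matrix of a linear deviation are only determined up to shifts. If they are chosen
reduced, the shifts that balance the flow at the decision points `j` have nonnegative potentials,
and these form the rows of the matrix `B`. -/
theorem exists_mem_utcPolytope_of_linearDeviation {φ : P.Deviation} (hφ : φ ∈ P.linearDeviations) :
    ∃ z ∈ P.utcPolytope, ∀ x : P.X, φ x = (devMatrix z).mulVec x := by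
  obtain ⟨A, hred, hnonneg, hdot⟩ := exists_isReduced_rows hφ
  have hflow := fun x => isFlow_of_mem_coX (hφ.1 x)
  have hroot : A P.root = Pi.single P.root 1 := by
    refine (hred _).eq (fun k => ⟨fun a => by simp, Classical.arbitrary _, by simp⟩) fun x hx => ?_
    rw [single_one_dotProduct, (isFlow_of_mem_X hx).root]
    exact (hdot _ ⟨x, hx⟩).trans (hflow _).root
  have hbalance : ∀ j, ∃ b : P.Dec → ℝ, (∀ k, 0 ≤ b k) ∧
      A (P.parent j) = ∑ a, A (P.child j a) + shift b := fun j => by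
    refine (hred _).exists_nonneg_eq_add_shift (fun k a => ?_) fun x hx => ?_
    · rw [Finset.sum_apply]
      exact sum_nonneg fun _ _ => hnonneg _ _
    · rw [sum_dotProduct, hdot _ ⟨x, hx⟩, ← (hflow _).sum_child]
      exact Fintype.sum_congr _ _ fun a => (hdot _ ⟨x, hx⟩).symm
  choose B hB hAB using hbalance
  let z : P.Coord → ℝ := Sum.elim (fun p => A p.1 p.2) fun p => B p.1 p.2
  refine ⟨z, ⟨fun v => ?_, ?_, fun τ hτ => ?_, ?_⟩, fun x => funext fun σ => (hdot σ x).symm⟩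
  · exact (forall_arrival_eq_iff z v.1).2 (hAB v.1) v.2
  · simp [z, hroot]
  · simp [z, hroot, hτ]
  · rintro (e | e)
    exacts [hnonneg _ _, hB _ _]

end Polytope

end TreeFormDecisionProblem

/-! ### Local strategies generate points of the UTC polytope -/

namespace TreeFormDecisionProblem

section Generates

variable {P : TreeFormDecisionProblem.{u}}

/-- The pair of matrices `z` arises from the local strategies `β` by multiplication along the UTC
decision problem. -/
structure Generates (β : ∀ v : P.UDec, P.Choice v → ℝ) (z : P.Coord → ℝ) : Prop where
  root : ∀ τ, z (.inl (P.root, τ)) = P.rootPoint (.inl (P.root, τ))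
  choice : ∀ v i, z (choiceCoord v i) = β v i * arrival v z

theorem exists_generates (β : ∀ v : P.UDec, P.Choice v → ℝ) : ∃ z, Generates β z := by
  obtain ⟨z, hz⟩ := exists_forall_eq_of_wellFounded (measure P.coordDepth).wf
    (fun (z : P.Coord → ℝ) (e : P.Coord) => match e with
      | .inl (none, τ) => P.rootPoint (.inl (P.root, τ))
      | .inl (some ⟨j, a⟩, τ) => β (j, τ) (.inl a) * arrival (j, τ) z
      | .inr (j, k) => β (j, P.parent k) (.inr ⟨k, rfl⟩) * arrival (j, P.parent k) z)
    fun f g e h => by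
      have harrival : ∀ v i, choiceCoord v i = e → arrival v f = arrival v g :=
        fun v i hi => arrival_congr fun e' he' => h e' (hi ▸ he'.coordDepth_lt i)
      rcases e with ⟨_ | ⟨j, a⟩, τ⟩ | ⟨j, k⟩
      exacts [rfl, congrArg _ (harrival (j, τ) (.inl a) rfl),
        congrArg _ (harrival (j, P.parent k) (.inr ⟨k, rfl⟩) rfl)]
  refine ⟨z, fun τ => hz _, ?_⟩
  rintro ⟨j, τ⟩ (a | ⟨k, (rfl : P.parent k = τ)⟩)
  exacts [hz _, hz _]

namespace Generates

variable {β β' : ∀ v : P.UDec, P.Choice v → ℝ} {z z' : P.Coord → ℝ}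

theorem mem_utcPolytope (hz : Generates β z) (hβ : ∀ v, β v ∈ stdSimplex ℝ (P.Choice v)) :
    z ∈ P.utcPolytope := by
  refine ⟨fun v => ?_, ?_, fun τ hτ => ?_, fun e => ?_⟩
  · simp only [hz.choice, ← sum_mul, (hβ v).2, one_mul]
  · rw [hz.root, rootPoint_inl_root, if_pos rfl]
  · rw [hz.root, rootPoint_inl_root, if_neg hτ]
  · induction e using coord_induction with
    | root τ =>
      rw [hz.root, rootPoint_inl_root]
      split_ifs
      exacts [zero_le_one, le_rfl]
    | choice v ih i =>
      rw [hz.choice]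
      exact mul_nonneg ((hβ v).1 i) (arrival_nonneg ih)

theorem eq_of_coordDepth_le (hz : Generates β z) (hz' : Generates β' z') {n : ℕ}
    (h : ∀ v, P.decDepth v < n → β v = β' v) {e : P.Coord} (he : P.coordDepth e ≤ n) :
    z e = z' e := by
  induction e using coord_induction with
  | root τ => rw [hz.root, hz'.root]
  | choice v ih i =>
    rw [coordDepth_choiceCoord] at he
    rw [hz.choice, hz'.choice, h v he,
      arrival_congr fun e hev => ih e hev (hev.coordDepth_eq.trans_le (Nat.le_of_succ_le he))]

end Generates

/-- The pair of matrices that arises from the local strategies `β`. -/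
noncomputable def generated (β : ∀ v : P.UDec, P.Choice v → ℝ) : P.Coord → ℝ :=
  (exists_generates β).choose

theorem generates_generated (β : ∀ v : P.UDec, P.Choice v → ℝ) : Generates β (generated β) :=
  (exists_generates β).choose_spec

end Generates

/-! ### Pure deviators -/

section Deviators

variable {P : TreeFormDecisionProblem.{u}}

/-- The local strategies of a pure deviator. -/
def pointStrategy (s : P.PureDeviator) (v : P.UDec) : P.Choice v → ℝ := Pi.single (s v) 1

theorem pointStrategy_mem_stdSimplex (s : P.PureDeviator) (v : P.UDec) :
    pointStrategy s v ∈ stdSimplex ℝ (P.Choice v) :=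
  single_mem_stdSimplex ℝ (s v)

/-- The mass at a node of the UTC decision problem if the deviator plays the pair of matrices `z`
and the mediator plays `x`. -/
def nodeMass (z : P.Coord → ℝ) (x : P.Seq → ℝ) : P.UNode → ℝ
  | .obs σ τ => z (.inl (σ, τ)) * x τ
  | .dec j τ => arrival (j, τ) z * x τ
  | .query j k => z (.inr (j, k)) * x (P.parent k)

/-- The node that carries a coordinate of the UTC polytope. -/
def coordNode : P.Coord → P.UNode
  | .inl (σ, τ) => .obs σ τ
  | .inr (j, k) => .query j k

theorem nodeMass_coordNode_choiceCoord (z : P.Coord → ℝ) (x : P.Seq → ℝ) (v : P.UDec)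
    (i : P.Choice v) :
    nodeMass z x (coordNode (choiceCoord v i)) = z (choiceCoord v i) * x v.2 := by
  obtain ⟨j, τ⟩ := v
  rcases i with a | ⟨k, (rfl : P.parent k = τ)⟩ <;> rfl

theorem Reaches.coordNode_choiceCoord {s : P.PureDeviator} {x : P.X} {v : P.UDec}
    (h : Reaches s x (.dec v.1 v.2)) : Reaches s x (coordNode (choiceCoord v (s v))) := by
  obtain ⟨j, τ⟩ := v
  rcases hs : s (j, τ) with a | k
  exacts [.play j τ a h hs, .ask j τ k h hs]

theorem eq_one_of_mem_X_of_ne_zero {x : P.Seq → ℝ} (hx : x ∈ P.X) {σ : P.Seq} (h : x σ ≠ 0) :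
    x σ = 1 := by
  obtain ⟨plan, rfl⟩ := hx
  exact (pureVector_zero_or_one plan σ).resolve_left h

namespace Generates

variable {s : P.PureDeviator} {z : P.Coord → ℝ}

section PointStrategy

theorem mem_utcPolytope_of_pointStrategy (hz : Generates (pointStrategy s) z) : z ∈ P.utcPolytope :=
  hz.mem_utcPolytope (pointStrategy_mem_stdSimplex s)

theorem apply_choiceCoord_of_pointStrategy (hz : Generates (pointStrategy s) z) (v : P.UDec)
    (i : P.Choice v) :
    z (choiceCoord v i) = if i = s v then arrival v z else 0 := by
  rw [hz.choice, pointStrategy, Pi.single_apply, ite_mul, one_mul, zero_mul]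

theorem zero_or_one_of_pointStrategy (hz : Generates (pointStrategy s) z) (e : P.Coord) :
    z e = 0 ∨ z e = 1 := by
  have hmem := hz.mem_utcPolytope_of_pointStrategy
  induction e using coord_induction with
  | root τ =>
    rw [hz.root, rootPoint_inl_root]
    exact (ite_eq_or_eq _ _ _).symm
  | choice v ih i =>
    have harrival : arrival v z = 0 ∨ arrival v z = 1 := by
      refine or_iff_not_imp_left.2 fun h => ?_
      obtain ⟨e, hev, he⟩ := exists_feeds_ne_zero h
      exact (arrival_le_one_of_mem_utcPolytope hmem v).antisymm
        (((ih e hev).resolve_left he).symm.trans_le (hev.le_arrival hmem.2.2.2))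
    rw [hz.apply_choiceCoord_of_pointStrategy]
    split_ifs
    exacts [harrival, .inl rfl]

theorem arrival_ne_zero_of_feeds (hz : Generates (pointStrategy s) z) {e : P.Coord}
    {v : P.UDec} (hev : Feeds e v) (he : z e ≠ 0) :
    arrival v z ≠ 0 := by
  have hnonneg := hz.mem_utcPolytope_of_pointStrategy.2.2.2
  exact (((hnonneg e).lt_of_ne' he).trans_le (hev.le_arrival hnonneg)).ne'

theorem nodeMass_ne_zero_of_reaches (hz : Generates (pointStrategy s) z) {x : P.X}
    {n : P.UNode} (h : Reaches s x n) :
    nodeMass z x n ≠ 0 := by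
  have hchoice : ∀ (v : P.UDec) i, s v = i → nodeMass z x (.dec v.1 v.2) ≠ 0 →
      nodeMass z x (coordNode (choiceCoord v i)) ≠ 0 := by
    rintro v _ rfl h
    rwa [nodeMass_coordNode_choiceCoord, hz.apply_choiceCoord_of_pointStrategy, if_pos rfl]
  induction h with
  | root => simp [nodeMass, hz.root, rootPoint_inl_root, (isFlow_of_mem_X x.2).root]
  | observe j τ _ ih =>
    exact mul_ne_zero (hz.arrival_ne_zero_of_feeds (.observe j τ) (left_ne_zero_of_mul ih))
      (right_ne_zero_of_mul ih)
  | play j τ a _ hs ih => exact hchoice (j, τ) (.inl a) hs ih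
  | ask j τ k _ hs ih => exact hchoice (j, τ) (.inr k) hs ih
  | reply j k a _ hx ih =>
    exact mul_ne_zero (hz.arrival_ne_zero_of_feeds (.reply j k a) (left_ne_zero_of_mul ih))
      (hx.trans_ne one_ne_zero)

theorem reaches_of_nodeMass_ne_zero (hz : Generates (pointStrategy s) z) {x : P.X} {e : P.Coord}
    (h : nodeMass z x (coordNode e) ≠ 0) : Reaches s x (coordNode e) := by
  have hx := isFlow_of_mem_X x.2
  induction e using coord_induction with
  | root τ =>
    have hroot := left_ne_zero_of_mul (a := z (.inl (P.root, τ))) h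
    rw [hz.root, rootPoint_inl_root] at hroot
    obtain rfl : τ = P.root := by_contra fun hne => hroot (if_neg hne)
    exact .root
  | choice v ih i =>
    rw [nodeMass_coordNode_choiceCoord, hz.apply_choiceCoord_of_pointStrategy] at h
    obtain rfl : i = s v := by_contra fun hne => h (by rw [if_neg hne, zero_mul])
    rw [if_pos rfl] at h
    obtain ⟨e, hev, he⟩ := exists_feeds_ne_zero (left_ne_zero_of_mul h)
    have hxv := right_ne_zero_of_mul h
    refine Reaches.coordNode_choiceCoord ?_
    cases hev with
    | observe j τ => exact .observe j τ (ih _ (.observe j τ) (mul_ne_zero he hxv))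
    | reply j k a =>
      have hxk : (x : P.Seq → ℝ) (P.parent k) ≠ 0 :=
        (((hx.nonneg _).lt_of_ne' hxv).trans_le (hx.child_le k a)).ne'
      exact .reply j k a (ih _ (.reply j k a) (mul_ne_zero he hxk))
        (eq_one_of_mem_X_of_ne_zero x.2 hxv)

theorem nodeMass_obs_eq_one_of_reaches (hz : Generates (pointStrategy s) z)
    {x : P.X} {σ τ : P.Seq} (h : Reaches s x (.obs σ τ)) :
    nodeMass z x (.obs σ τ) = 1 := by
  have hne := hz.nodeMass_ne_zero_of_reaches h
  rw [nodeMass, (hz.zero_or_one_of_pointStrategy _).resolve_left (left_ne_zero_of_mul hne),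
    eq_one_of_mem_X_of_ne_zero x.2 (right_ne_zero_of_mul hne), one_mul]

theorem pureDeviation_eq_mulVec (hz : Generates (pointStrategy s) z) (x : P.X) :
    pureDeviation s x = (devMatrix z).mulVec x := by
  have hmem := hz.mem_utcPolytope_of_pointStrategy
  have hx := isFlow_of_mem_X x.2
  funext σ
  have hsum : (devMatrix z).mulVec x σ = ∑ τ, nodeMass z x (.obs σ τ) := rfl
  unfold pureDeviation
  split_ifs with h
  · obtain ⟨τ, h⟩ := h
    refine le_antisymm ?_ ((isFlow_mulVec_of_mem_utcPolytope hmem hx).le_one σ)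
    rw [hsum, ← hz.nodeMass_obs_eq_one_of_reaches h]
    exact single_le_sum (f := fun τ => nodeMass z (x : P.Seq → ℝ) (.obs σ τ))
      (fun τ _ => mul_nonneg (hmem.2.2.2 _) (hx.nonneg τ)) (mem_univ τ)
  · rw [hsum]
    exact (sum_eq_zero fun τ _ => by_contra fun hne =>
      h ⟨τ, hz.reaches_of_nodeMass_ne_zero (e := .inl (σ, τ)) hne⟩).symm

end PointStrategy

end Generates

theorem pureDeviation_mem_X (s : P.PureDeviator) (x : P.X) : pureDeviation s x ∈ P.X := by
  have hz := generates_generated (pointStrategy s)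
  have hflow : IsFlow (pureDeviation s x) := by
    rw [hz.pureDeviation_eq_mulVec]
    exact isFlow_mulVec_of_mem_utcPolytope hz.mem_utcPolytope_of_pointStrategy
      (isFlow_of_mem_X x.2)
  refine hflow.mem_X fun σ => ?_
  unfold pureDeviation
  split_ifs
  exacts [.inr rfl, .inl rfl]

theorem apply_mem_coX_of_mem_utcDeviations {φ : P.Deviation} (hφ : φ ∈ P.utcDeviations)
    (x : P.X) : φ x ∈ P.coX := by
  obtain ⟨μ, hμ, rfl⟩ := hφ
  rw [Finset.sum_apply]
  exact (convex_convexHull ℝ P.X).sum_mem (fun s _ => hμ.1 s) hμ.2 fun s _ =>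
    subset_convexHull ℝ _ (pureDeviation_mem_X s x)

theorem sum_smul_pureDeviation (μ : P.PureDeviator → ℝ) :
    ∑ s, μ s • pureDeviation s = fun x : P.X =>
      (devMatrix (∑ s, μ s • generated (pointStrategy s))).mulVec x := by
  funext x σ
  simp only [Finset.sum_apply, Pi.smul_apply, smul_eq_mul, Matrix.mulVec, dotProduct, devMatrix,
    Matrix.of_apply, sum_mul, (generates_generated (pointStrategy _)).pureDeviation_eq_mulVec,
    mul_sum]
  rw [sum_comm]
  simp only [mul_assoc]

theorem convex_utcPolytope : Convex ℝ P.utcPolytope := by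
  rintro y ⟨hy, hyroot, hyne, hy0⟩ z ⟨hz, hzroot, hzne, hz0⟩ a b ha hb hab
  refine ⟨fun v => ?_, ?_, fun τ hτ => ?_, fun e => ?_⟩
  · rw [(isLinearMap_arrival v).map_add, (isLinearMap_arrival v).map_smul,
      (isLinearMap_arrival v).map_smul, hy, hz]
    simp only [smul_sum, Pi.add_apply, Pi.smul_apply, sum_add_distrib]
  · simp [hyroot, hzroot, hab]
  · simp [hyne τ hτ, hzne τ hτ]
  · exact add_nonneg (mul_nonneg ha (hy0 e)) (mul_nonneg hb (hz0 e))

theorem exists_mem_utcPolytope_of_mem_utcDeviations {φ : P.Deviation}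
    (hφ : φ ∈ P.utcDeviations) : ∃ z ∈ P.utcPolytope, ∀ x : P.X, φ x = (devMatrix z).mulVec x := by
  obtain ⟨μ, hμ, rfl⟩ := hφ
  exact ⟨_, convex_utcPolytope.sum_mem (fun s _ => hμ.1 s) hμ.2 fun s _ =>
    (generates_generated _).mem_utcPolytope_of_pointStrategy, congrFun (sum_smul_pureDeviation μ)⟩

end Deviators

/-! ### Kuhn's theorem for deviators -/

section Kuhn

variable {P : TreeFormDecisionProblem.{u}} {β : ∀ v : P.UDec, P.Choice v → ℝ} {z : P.Coord → ℝ}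

theorem arrival_generated_update (s : P.PureDeviator) (v : P.UDec) (i : P.Choice v) :
    arrival v (generated (pointStrategy (Function.update s v i))) =
      arrival v (generated (pointStrategy s)) := by
  refine arrival_congr fun e he => (generates_generated _).eq_of_coordDepth_le
    (generates_generated _) (n := P.decDepth v) (fun u hu => ?_) he.coordDepth_eq.le
  rw [pointStrategy, pointStrategy, Function.update_of_ne (ne_of_apply_ne P.decDepth hu.ne)]

namespace Generates

/- The deviator chooses independently at all decision points. What arrives at `v` depends only on
the choices before `v`, hence is independent of the choice at `v`. -/
theorem sum_prod_smul_generated_pointStrategy (hz : Generates β z)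
    (hβ : ∀ v, β v ∈ stdSimplex ℝ (P.Choice v)) :
    ∑ s : P.PureDeviator, (∏ v, β v (s v)) • generated (pointStrategy s) = z := by
  funext e
  induction e using coord_induction with
  | root τ =>
    simp only [Finset.sum_apply, Pi.smul_apply, (generates_generated _).root, hz.root]
    rw [← sum_smul, (prod_mem_stdSimplex hβ).2, one_smul]
  | choice v ih i =>
    simp only [Finset.sum_apply, Pi.smul_apply, smul_eq_mul, (generates_generated _).choice,
      hz.choice, pointStrategy]
    rw [sum_prod_mul_mul_of_update_eq (hβ v).2
      (fun a => Pi.single (M := fun _ : P.Choice v => ℝ) a 1 i)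
      (fun s a => arrival_generated_update s v a), ← arrival_sum_smul, arrival_congr ih]
    simp [Pi.single_apply]

theorem mem_utcDeviations
    (hz : Generates β z) (hβ : ∀ v, β v ∈ stdSimplex ℝ (P.Choice v)) :
    (fun x : P.X => (devMatrix z).mulVec x) ∈ P.utcDeviations :=
  ⟨_, prod_mem_stdSimplex hβ, by
    rw [sum_smul_pureDeviation, hz.sum_prod_smul_generated_pointStrategy hβ]⟩

theorem mapsTo_coX
    (hz : Generates β z) (hβ : ∀ v, β v ∈ stdSimplex ℝ (P.Choice v)) :
    Set.MapsTo (devMatrix z).mulVec P.coX P.coX :=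
  convexHull_min (t := (devMatrix z).mulVecLin ⁻¹' P.coX)
    (fun x hx => apply_mem_coX_of_mem_utcDeviations (hz.mem_utcDeviations hβ) ⟨x, hx⟩)
    ((convex_convexHull ℝ P.X).linear_preimage _)

end Generates

end Kuhn

theorem exists_isFixedPointOracle (P : TreeFormDecisionProblem.{u}) :
    ∃ fixpt : Matrix P.Seq P.Seq ℝ → P.Seq → ℝ, IsFixedPointOracle fixpt := by
  have hfixed : ∀ M : Matrix P.Seq P.Seq ℝ, ∃ x : P.Seq → ℝ,
      Set.MapsTo M.mulVec P.coX P.coX → x ∈ P.coX ∧ M.mulVec x = x := by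
    intro M
    by_cases hM : Set.MapsTo M.mulVec P.coX P.coX
    · have hne : P.coX.Nonempty := (Set.range_nonempty P.pureVector).convexHull
      obtain ⟨x, hx, hMx⟩ := exists_mem_apply_eq_of_isCompact_of_convex
        M.mulVecLin.toContinuousLinearMap
        ((Set.finite_range P.pureVector).isCompact_convexHull (𝕜 := ℝ)) (convex_convexHull ℝ P.X)
        hne hM
      exact ⟨x, fun _ => ⟨hx, hMx⟩⟩
    · exact ⟨0, fun h => absurd h hM⟩
  choose fixpt hfixpt using hfixed
  exact ⟨fixpt, hfixpt⟩

end TreeFormDecisionProblem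

/-! ### The chain of scaled extensions -/

theorem mem_scaledExtension_iff {E : Type u} {S : Set (E → ℝ)} {h : (E → ℝ) → ℝ} {G : Finset E}
    (hG : G.Nonempty) (hS : ∀ y ∈ S, 0 ≤ h y ∧ ∀ e ∈ G, y e = 0) {z : E → ℝ} :
    z ∈ scaledExtension S h G ↔
      ∃ y ∈ S, (∀ e ∉ G, z e = y e) ∧ (∀ e ∈ G, 0 ≤ z e) ∧ h y = ∑ e ∈ G, z e := by
  classical
  constructor
  · rintro ⟨y, hy, w, hw0, hwG, hw1, rfl⟩
    have hadd : ∀ e ∈ G, (y + h y • w) e = h y * w e := fun e he => by simp [(hS y hy).2 e he]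
    refine ⟨y, hy, fun e he => by simp [hwG e he], fun e he => ?_, ?_⟩
    · exact (mul_nonneg (hS y hy).1 (hw0 e)).trans_eq (hadd e he).symm
    · rw [sum_congr rfl hadd, ← mul_sum, hw1, mul_one]
  · rintro ⟨y, hy, hyz, hz, hsum⟩
    obtain ⟨w, hw0, hwG, hw1, hzw⟩ := exists_eq_sum_mul_of_nonneg hG hz
    refine ⟨y, hy, w, hw0, hwG, hw1, funext fun e => ?_⟩
    by_cases he : e ∈ G
    · rw [Pi.add_apply, (hS y hy).2 e he, zero_add, Pi.smul_apply, smul_eq_mul, hsum, hzw e he]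
    · rw [Pi.add_apply, Pi.smul_apply, hwG e he, smul_zero, add_zero, hyz e he]

namespace TreeFormDecisionProblem

section Chain

variable {P : TreeFormDecisionProblem.{u}}

/-- The coordinates of the choices at `v`. -/
def choiceCoords (v : P.UDec) : Finset P.Coord := univ.image (choiceCoord v)

theorem mem_choiceCoords {v : P.UDec} {e : P.Coord} :
    e ∈ choiceCoords v ↔ ∃ i, choiceCoord v i = e := by
  simp [choiceCoords]

theorem choiceCoords_nonempty (v : P.UDec) : (choiceCoords v).Nonempty :=
  univ_nonempty.image _

theorem choiceCoord_notMem_choiceCoords {u v : P.UDec} (h : u ≠ v) (i : P.Choice u) :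
    choiceCoord u i ∉ choiceCoords v := by
  rw [mem_choiceCoords]
  rintro ⟨i', hi⟩
  exact h (congrArg Sigma.fst (sigma_choiceCoord_injective (a₁ := ⟨u, i⟩) (a₂ := ⟨v, i'⟩) hi.symm))

theorem root_notMem_choiceCoords (v : P.UDec) (τ : P.Seq) :
    .inl (P.root, τ) ∉ choiceCoords v := by
  rw [mem_choiceCoords]
  exact fun ⟨i, hi⟩ => choiceCoord_ne_root v i τ hi

theorem Feeds.notMem_choiceCoords {e : P.Coord} {u v : P.UDec} (he : Feeds e u)
    (h : P.decDepth u ≤ P.decDepth v) : e ∉ choiceCoords v := by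
  rw [mem_choiceCoords]
  rintro ⟨i, rfl⟩
  have := he.coordDepth_eq
  rw [coordDepth_choiceCoord] at this
  omega

theorem sum_choiceCoords (v : P.UDec) (z : P.Coord → ℝ) :
    ∑ e ∈ choiceCoords v, z e = ∑ i, z (choiceCoord v i) :=
  sum_image fun _ _ _ _ h => sigma_mk_injective (sigma_choiceCoord_injective h)

theorem mem_rootCoords {e : P.Coord} : e ∈ P.rootCoords ↔ ∃ τ, e = .inl (P.root, τ) := by
  simp [rootCoords, eq_comm]

theorem rootPoint_eq_zero {e : P.Coord} (he : e ∉ P.rootCoords) : P.rootPoint e = 0 :=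
  Pi.single_eq_of_ne (fun h => he (mem_rootCoords.2 ⟨_, h⟩)) _

/-- The coordinates of the choices at the decision points in `l`, together with the coordinates of
the starting point. -/
def coordsUpTo (l : List P.UDec) : Finset P.Coord :=
  P.rootCoords ∪ l.toFinset.biUnion choiceCoords

/-- The points on the coordinates `coordsUpTo l` that satisfy the constraints of the UTC polytope
at the decision points in `l`. -/
def polytopeUpTo (l : List P.UDec) : Set (P.Coord → ℝ) :=
  {z | (∀ v ∈ l, arrival v z = ∑ i, z (choiceCoord v i)) ∧
    (∀ τ, z (.inl (P.root, τ)) = P.rootPoint (.inl (P.root, τ))) ∧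
    (∀ e, 0 ≤ z e) ∧ ∀ e ∉ coordsUpTo l, z e = 0}

theorem coordsUpTo_nil : coordsUpTo (P := P) [] = P.rootCoords := by
  simp [coordsUpTo]

theorem coordsUpTo_append_singleton (l : List P.UDec) (v : P.UDec) :
    coordsUpTo (l ++ [v]) = coordsUpTo l ∪ choiceCoords v := by
  ext e
  simp only [coordsUpTo, mem_union, mem_biUnion, List.mem_toFinset, List.mem_append,
    List.mem_singleton]
  grind

theorem coordsUpTo_eq_univ {l : List P.UDec} (hl : ∀ v, v ∈ l) : coordsUpTo l = univ := by
  refine eq_univ_of_forall fun e => ?_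
  obtain ⟨τ, rfl⟩ | ⟨v, i, rfl⟩ := eq_root_or_exists_choiceCoord e
  · exact mem_union_left _ (mem_rootCoords.2 ⟨_, rfl⟩)
  · exact mem_union_right _
      (mem_biUnion.2 ⟨v, List.mem_toFinset.2 (hl v), mem_choiceCoords.2 ⟨i, rfl⟩⟩)

theorem disjoint_coordsUpTo_choiceCoords {l : List P.UDec} {v : P.UDec} (hv : v ∉ l) :
    Disjoint (coordsUpTo l) (choiceCoords v) := by
  rw [Finset.disjoint_left]
  intro e he
  simp only [coordsUpTo, mem_union, mem_rootCoords, mem_biUnion, List.mem_toFinset] at he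
  rcases he with ⟨τ, rfl⟩ | ⟨u, hu, he⟩
  · exact root_notMem_choiceCoords v τ
  · obtain ⟨i, rfl⟩ := mem_choiceCoords.1 he
    exact choiceCoord_notMem_choiceCoords (ne_of_mem_of_not_mem hu hv) i

theorem polytopeUpTo_nil : polytopeUpTo (P := P) [] = {P.rootPoint} := by
  ext z
  rw [Set.mem_singleton_iff, polytopeUpTo, Set.mem_ofPred_eq, coordsUpTo_nil]
  constructor
  · rintro ⟨-, hroot, -, hzero⟩
    funext e
    by_cases he : e ∈ P.rootCoords
    · obtain ⟨τ, rfl⟩ := mem_rootCoords.1 he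
      exact hroot τ
    · rw [hzero e he, rootPoint_eq_zero he]
  · rintro rfl
    have hnonneg : (0 : P.Coord → ℝ) ≤ P.rootPoint := Pi.single_nonneg.2 zero_le_one
    exact ⟨by simp, fun _ => rfl, hnonneg, fun _ => rootPoint_eq_zero⟩

theorem mem_polytopeUpTo_append_singleton_iff {l : List P.UDec} {v : P.UDec} (hv : v ∉ l)
    (hl : ∀ u ∈ l, P.decDepth u ≤ P.decDepth v) {y z : P.Coord → ℝ}
    (hy : ∀ e ∈ choiceCoords v, y e = 0) (hyz : ∀ e ∉ choiceCoords v, z e = y e) :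
    z ∈ polytopeUpTo (l ++ [v]) ↔ y ∈ polytopeUpTo l ∧ (∀ e ∈ choiceCoords v, 0 ≤ z e) ∧
      arrival v y = ∑ e ∈ choiceCoords v, z e := by
  have harrival : ∀ u, P.decDepth u ≤ P.decDepth v → arrival u z = arrival u y := fun u hu =>
    arrival_congr fun e he => hyz e (he.notMem_choiceCoords hu)
  have hconstraint : ∀ u ∈ l, (arrival u z = ∑ i, z (choiceCoord u i) ↔
      arrival u y = ∑ i, y (choiceCoord u i)) := fun u hu => by
    rw [harrival u (hl u hu), Fintype.sum_congr _ _ fun i =>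
      hyz _ (choiceCoord_notMem_choiceCoords (ne_of_mem_of_not_mem hu hv) i)]
  have hroot := fun τ => hyz _ (root_notMem_choiceCoords v τ)
  simp only [polytopeUpTo, Set.mem_ofPred_eq, List.forall_mem_append, List.forall_mem_singleton,
    coordsUpTo_append_singleton, mem_union, not_or, and_imp, sum_choiceCoords, ← harrival v le_rfl,
    hroot]
  constructor
  · rintro ⟨⟨hlin, hvin⟩, hr, hnonneg, hzero⟩
    refine ⟨⟨fun u hu => (hconstraint u hu).1 (hlin u hu), hr, fun e => ?_, fun e he => ?_⟩,
      fun e _ => hnonneg e, hvin⟩ <;> by_cases hev : e ∈ choiceCoords v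
    · exact (hy e hev).ge
    · exact (hnonneg e).trans_eq (hyz e hev)
    · exact hy e hev
    · exact (hyz e hev).symm.trans (hzero e he hev)
  · rintro ⟨⟨hlin, hr, hnonneg, hzero⟩, hz, hvin⟩
    refine ⟨⟨fun u hu => (hconstraint u hu).2 (hlin u hu), hvin⟩, hr, fun e => ?_, fun e he hev =>
      (hyz e hev).trans (hzero e he)⟩
    by_cases hev : e ∈ choiceCoords v
    exacts [hz e hev, (hnonneg e).trans_eq (hyz e hev).symm]

theorem polytopeUpTo_append_singleton {l : List P.UDec} {v : P.UDec} (hv : v ∉ l)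
    (hl : ∀ u ∈ l, P.decDepth u ≤ P.decDepth v) :
    polytopeUpTo (l ++ [v]) = scaledExtension (polytopeUpTo l) (arrival v) (choiceCoords v) := by
  have hfresh : ∀ y ∈ polytopeUpTo l, ∀ e ∈ choiceCoords v, y e = 0 := fun y hy e he =>
    hy.2.2.2 e (Finset.disjoint_right.1 (disjoint_coordsUpTo_choiceCoords hv) he)
  classical
  ext z
  rw [mem_scaledExtension_iff (choiceCoords_nonempty v) fun y hy =>
    ⟨arrival_nonneg fun e _ => hy.2.2.1 e, hfresh y hy⟩]
  constructor
  · intro hz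
    have hoff : ∀ e ∉ choiceCoords v, z e = (choiceCoords v).piecewise (0 : P.Coord → ℝ) z e :=
        fun e he =>
      (Finset.piecewise_eq_of_notMem _ _ _ he).symm
    obtain ⟨hy, hrest⟩ := (mem_polytopeUpTo_append_singleton_iff hv hl
      (fun e he => Finset.piecewise_eq_of_mem _ _ _ he) hoff).1 hz
    exact ⟨_, hy, hoff, hrest⟩
  · rintro ⟨y, hy, hyz, hrest⟩
    exact (mem_polytopeUpTo_append_singleton_iff hv hl (hfresh y hy) hyz).2 ⟨hy, hrest⟩

theorem polytopeUpTo_eq_utcPolytope {l : List P.UDec} (hl : ∀ v, v ∈ l) :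
    polytopeUpTo l = P.utcPolytope := by
  ext z
  simp only [polytopeUpTo, Set.mem_ofPred_eq, coordsUpTo_eq_univ hl, mem_univ, not_true_eq_false,
    IsEmpty.forall_iff, implies_true, and_true, hl, forall_const, utcPolytope]
  refine and_congr_right fun _ => ?_
  rw [← and_assoc]
  refine and_congr_left fun _ => ⟨fun h => ⟨?_, fun τ hτ => ?_⟩, fun h τ => ?_⟩
  · rw [h, rootPoint_inl_root, if_pos rfl]
  · rw [h, rootPoint_inl_root, if_neg hτ]
  · rw [rootPoint_inl_root]
    split_ifs with hτ
    exacts [hτ ▸ h.1, h.2 τ hτ]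

theorem scaledExtensionChain_polytopeUpTo {l : List P.UDec} (hnodup : l.Nodup)
    (hl : l.Pairwise fun u v => P.decDepth u ≤ P.decDepth v) :
    ScaledExtensionChain P.rootPoint P.rootCoords
      (l.map fun v => (univ.image (choiceCoord v), arrival v)) (coordsUpTo l) (polytopeUpTo l) := by
  induction l using List.reverseRecOn with
  | nil =>
    rw [polytopeUpTo_nil, coordsUpTo_nil]
    exact .point fun e => rootPoint_eq_zero
  | append_singleton l v ih =>
    rw [List.nodup_append] at hnodup
    rw [List.pairwise_append] at hl
    have hv : v ∉ l := fun h => hnodup.2.2 v h v (List.mem_singleton_self v) rfl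
    rw [List.map_append, List.map_singleton, coordsUpTo_append_singleton,
      polytopeUpTo_append_singleton hv fun u hu => hl.2.2 u hu v (List.mem_singleton_self v)]
    exact .extend _ _ _ _ _ (ih hnodup.1 hl.1) (choiceCoords_nonempty v)
      (disjoint_coordsUpTo_choiceCoords hv) (isLinearMap_arrival v) fun y hy =>
        arrival_nonneg fun e _ => hy.2.2.1 e

end Chain

theorem exists_scaledExtensionChain (P : TreeFormDecisionProblem.{u}) :
    ∃ order : List P.UDec, order.Nodup ∧ (∀ v, v ∈ order) ∧
      ScaledExtensionChain P.rootPoint P.rootCoords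
        (order.map fun v => (univ.image (choiceCoord v), arrival v)) univ P.utcPolytope := by
  obtain ⟨l, hperm, hl⟩ := exists_perm_toList_pairwise_le P.decDepth
  have hnodup := hperm.nodup_iff.2 (nodup_toList _)
  have hmem : ∀ v, v ∈ l := fun v => hperm.mem_iff.2 (mem_toList.2 (mem_univ v))
  refine ⟨l, hnodup, hmem, ?_⟩
  rw [← coordsUpTo_eq_univ hmem, ← polytopeUpTo_eq_utcPolytope hmem]
  exact scaledExtensionChain_polytopeUpTo hnodup hl

end TreeFormDecisionProblem

/-! ### Regret of counterfactual regret minimization -/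

namespace TreeFormDecisionProblem

section Regret

variable {P : TreeFormDecisionProblem.{u}}

theorem uDec_induction {p : P.UDec → Prop}
    (step : ∀ j τ, (∀ a, ∀ k : P.Next (P.child j a), p (k.1, τ)) →
      (∀ k : P.Next τ, ∀ a, p (j, P.child k.1 a)) → p (j, τ)) (v : P.UDec) : p v := by
  induction v using (wellFounded_apply_gt P.decDepth).induction with
  | _ v ih =>
    refine step v.1 v.2 (fun a k => ih _ ?_) fun k a => ih _ ?_
    · exact Nat.add_lt_add_right (depth_lt_depth_of_parent_eq_child k.2) _
    · refine Nat.add_lt_add_left ?_ _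
      rw [seqDepth_child, ← seqDepth_parent, k.2]
      exact Nat.lt_succ_self _

theorem IsUtility.exists_value {w : P.Seq → ℝ} (hw : P.IsUtility w) :
    ∃ W : P.Dec → ℝ, (∀ j, W j ∈ Set.Icc 0 1) ∧
      ∀ j a, w (P.child j a) + ∑ k : P.Next (P.child j a), W k.1 ≤ W j := by
  -- `W j` is the best utility that can be obtained below `j`.
  obtain ⟨b, hb⟩ := exists_isReduced_add_shift (-w)
  have hstep : ∀ j a, w (P.child j a) + ∑ k : P.Next (P.child j a), -b k.1 ≤ -b j := fun j a => by
    have hcost := (hb j).1 a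
    rw [Pi.add_apply, Pi.neg_apply, shift_apply, before_child] at hcost
    rw [sum_neg_distrib]
    linarith
  have hnonneg : ∀ j, 0 ≤ -b j := fun j => by
    induction j using dec_induction with
    | step j ih =>
      exact (add_nonneg (hw.1 _).1 (sum_nonneg fun k _ => ih (Classical.arbitrary _) k)).trans
        (hstep j _)
  have hle : ∀ j, w (P.parent j) + ∑ k : P.Next (P.parent j), -b k.1 ≤ 1 → -b j ≤ 1 := fun j h =>
    (single_le_sum (f := fun k : P.Next (P.parent j) => -b k.1) (fun k _ => hnonneg k.1)
      (mem_univ ⟨j, rfl⟩)).trans ((le_add_of_nonneg_left (hw.1 _).1).trans h)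
  have hall : ∀ σ, w σ + ∑ k : P.Next σ, -b k.1 ≤ 1 := fun σ => by
    induction σ using seq_induction with
    | root =>
      obtain ⟨x, hx, hval⟩ := hb.exists_dotProduct_eq
      rw [add_shift_dotProduct (isFlow_of_mem_X hx), neg_dotProduct, Pi.add_apply, Pi.neg_apply,
        shift_apply, before_root] at hval
      rw [sum_neg_distrib]
      linarith [(hw.2 x hx).2]
    | child j ih a => exact (hstep j a).trans (hle j ih)
  exact ⟨fun j => -b j, fun j => ⟨hnonneg j, hle j (hall _)⟩, hstep⟩

theorem regretAgainst_eq_of_eq_mulVec {π : ℕ → P.X → ℝ} {w : ℕ → P.Seq → ℝ} {φ : P.Deviation}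
    {M : Matrix P.Seq P.Seq ℝ} (hφ : ∀ x : P.X, φ x = M.mulVec x) (T : ℕ) :
    regretAgainst π w T φ = ∑ t ∈ range T, w t ⬝ᵥ (M.mulVec (mean (π t)) - mean (π t)) := by
  refine sum_congr rfl fun t _ => ?_
  simp only [mean, Matrix.mulVec_sum, Matrix.mulVec_smul, hφ, ← sum_sub_distrib, ← smul_sub,
    dotProduct_sum, dotProduct_smul, smul_eq_mul]

theorem sum_play_utility (z : P.Coord → ℝ) (w x : P.Seq → ℝ) :
    ∑ j, ∑ τ, ∑ a, z (.inl (P.child j a, τ)) * (w (P.child j a) * x τ) =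
      w ⬝ᵥ (devMatrix z).mulVec x - w P.root * (devMatrix z).mulVec x P.root := by
  rw [dotProduct, sum_seq, add_sub_cancel_left]
  refine Fintype.sum_congr _ _ fun j => ?_
  rw [sum_comm]
  simp only [Matrix.mulVec, dotProduct, mul_sum, devMatrix, Matrix.of_apply]
  exact Fintype.sum_congr _ _ fun a => Fintype.sum_congr _ _ fun τ => mul_left_comm _ _ _

theorem sum_play_value (z : P.Coord → ℝ) (V : P.UDec → ℝ) :
    ∑ j, ∑ τ, ∑ a, z (.inl (P.child j a, τ)) * ∑ k : P.Next (P.child j a), V (k.1, τ) =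
      ∑ j, ∑ τ, z (.inl (P.parent j, τ)) * V (j, τ) -
        ∑ τ, z (.inl (P.root, τ)) * ∑ k : P.Next P.root, V (k.1, τ) := by
  have hcolumn : ∀ τ, ∑ j, z (.inl (P.parent j, τ)) * V (j, τ) =
      z (.inl (P.root, τ)) * ∑ k : P.Next P.root, V (k.1, τ) +
        ∑ j, ∑ a, z (.inl (P.child j a, τ)) * ∑ k : P.Next (P.child j a), V (k.1, τ) := fun τ => by
    rw [← sum_next fun σ k => z (.inl (σ, τ)) * V (k, τ)]
    simp only [← mul_sum]
    rw [sum_seq fun σ => z (.inl (σ, τ)) * ∑ k : P.Next σ, V (k.1, τ)]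
  rw [sum_comm, sum_comm (f := fun j τ => z (.inl (P.parent j, τ)) * V (j, τ)),
    Fintype.sum_congr _ _ hcolumn, sum_add_distrib, add_sub_cancel_left]

theorem sum_query_value (z : P.Coord → ℝ) (V : P.UDec → ℝ) :
    ∑ j, ∑ τ, ∑ k : P.Next τ, z (.inr (j, k.1)) * ∑ a, V (j, P.child k.1 a) =
      ∑ j, ∑ τ, before (fun k => z (.inr (j, k))) τ * V (j, τ) := by
  refine Fintype.sum_congr _ _ fun j => ?_
  rw [sum_next fun _ k => z (.inr (j, k)) * ∑ a, V (j, P.child k a), sum_seq]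
  simp only [before_root, zero_mul, zero_add, before_child, mul_sum]

namespace CFRRun

variable {R : ∀ v : P.UDec, LocalMinimizer (P.Choice v)} {w : ℕ → P.Seq → ℝ}

theorem strat_mem_stdSimplex (run : P.CFRRun R w) (t : ℕ) (v : P.UDec) :
    run.strat t v ∈ stdSimplex ℝ (P.Choice v) := by
  rw [run.strat_eq]
  exact (R v).next_mem _

theorem generates (run : P.CFRRun R w) (t : ℕ) : Generates (run.strat t) (run.dev t) where
  root τ := by
    rw [rootPoint_inl_root]
    split_ifs with hτ
    exacts [hτ ▸ run.dev_root t, run.dev_root_of_ne t τ hτ]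
  choice := run.dev_choice t

theorem dev_mem_utcPolytope (run : P.CFRRun R w) (t : ℕ) : run.dev t ∈ P.utcPolytope :=
  (run.generates t).mem_utcPolytope (run.strat_mem_stdSimplex t)

theorem value_mem_Icc (run : P.CFRRun R w) {t : ℕ} {v : P.UDec} {c : ℝ}
    (h : ∀ i, run.gain t v i ∈ Set.Icc 0 c) : run.value t v ∈ Set.Icc 0 c := by
  have hs := run.strat_mem_stdSimplex t v
  rw [run.value_eq]
  refine ⟨sum_nonneg fun i _ => mul_nonneg (hs.1 i) (h i).1, ?_⟩
  calc ∑ i, run.strat t v i * run.gain t v i ≤ ∑ i, run.strat t v i * c :=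
        sum_le_sum fun i _ => mul_le_mul_of_nonneg_left (h i).2 (hs.1 i)
    _ = c := by rw [← sum_mul, hs.2, one_mul]

theorem gain_mem_Icc_mul (run : P.CFRRun R w) {t : ℕ} (hw : P.IsUtility (w t)) {W : P.Dec → ℝ}
    (hW : ∀ j a, w t (P.child j a) + ∑ k : P.Next (P.child j a), W k.1 ≤ W j) (v : P.UDec)
    (i : P.Choice v) : run.gain t v i ∈ Set.Icc 0 (run.x t v.2 * W v.1) := by
  have hx := isFlow_of_mem_coX (run.x_mem t)
  induction v using uDec_induction with
  | step j τ hplay hquery =>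
    rcases i with a | k
    · have hvalue := fun k => run.value_mem_Icc (hplay a k)
      rw [run.gain_play]
      refine ⟨add_nonneg (mul_nonneg (hw.1 _).1 (hx.nonneg τ))
        (sum_nonneg fun k _ => (hvalue k).1), ?_⟩
      calc w t (P.child j a) * run.x t τ + ∑ k : P.Next (P.child j a), run.value t (k.1, τ)
          ≤ w t (P.child j a) * run.x t τ + ∑ k : P.Next (P.child j a), run.x t τ * W k.1 := by
            gcongr with k
            exact (hvalue k).2
        _ = run.x t τ * (w t (P.child j a) + ∑ k : P.Next (P.child j a), W k.1) := by
            rw [← mul_sum, mul_add, mul_comm (w t _)]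
        _ ≤ run.x t τ * W j := mul_le_mul_of_nonneg_left (hW j a) (hx.nonneg τ)
    · have hvalue := fun a => run.value_mem_Icc (hquery k a)
      rw [run.gain_query]
      refine ⟨sum_nonneg fun a _ => (hvalue a).1, ?_⟩
      calc ∑ a, run.value t (j, P.child k.1 a)
          ≤ ∑ a, run.x t (P.child k.1 a) * W j := sum_le_sum fun a _ => (hvalue a).2
        _ = run.x t τ * W j := by rw [← sum_mul, hx.sum_child, k.2]

theorem gain_mem_Icc (run : P.CFRRun R w) {t : ℕ} (hw : P.IsUtility (w t)) (v : P.UDec)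
    (i : P.Choice v) : run.gain t v i ∈ Set.Icc (0 : ℝ) 1 := by
  obtain ⟨W, hW01, hW⟩ := hw.exists_value
  have hgain := run.gain_mem_Icc_mul hw hW v i
  exact ⟨hgain.1, hgain.2.trans
    (mul_le_one₀ ((isFlow_of_mem_coX (run.x_mem t)).le_one _) (hW01 _).1 (hW01 _).2)⟩

/-- The advantage of the point `z` over the local strategy of a CFR run at `v` in step `t`: the
difference of the counterfactual utilities, weighted by the mass of `z` that arrives at `v`. -/
def advantage (run : P.CFRRun R w) (z : P.Coord → ℝ) (t : ℕ) (v : P.UDec) : ℝ :=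
  ∑ i, z (choiceCoord v i) * run.gain t v i - arrival v z * run.value t v

/- The values of later decision points telescope, as the mass that is sent to a decision point is
the mass that arrives there. -/
theorem sum_advantage (run : P.CFRRun R w) (t : ℕ) {z : P.Coord → ℝ} (hz : z ∈ P.utcPolytope) :
    ∑ v, run.advantage z t v = w t ⬝ᵥ (devMatrix z).mulVec (run.x t) -
      (w t P.root + ∑ k : P.Next P.root, run.value t (k.1, P.root)) := by
  have hroot := (isFlow_mulVec_of_mem_utcPolytope hz (isFlow_of_mem_coX (run.x_mem t))).root
  have hstart : ∑ τ, z (.inl (P.root, τ)) * ∑ k : P.Next P.root, run.value t (k.1, τ) =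
      ∑ k : P.Next P.root, run.value t (k.1, P.root) := by
    simp only [apply_root_of_mem_utcPolytope hz, rootPoint_inl_root, ite_mul, one_mul, zero_mul,
      sum_ite_eq', mem_univ, if_true]
  simp only [advantage, Fintype.sum_prod_type, Fintype.sum_sum_type, choiceCoord, run.gain_play,
    run.gain_query, arrival_eq_add_before, sum_sub_distrib, sum_add_distrib, mul_add, add_mul,
    sum_play_utility, sum_play_value, sum_query_value, hroot, hstart]
  ring

theorem sum_advantage_dev (run : P.CFRRun R w) (t : ℕ) :
    ∑ v, run.advantage (run.dev t) t v = 0 := by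
  refine sum_eq_zero fun v _ => ?_
  rw [advantage, run.value_eq, mul_sum, sub_eq_zero]
  exact Fintype.sum_congr _ _ fun i => by rw [run.dev_choice, mul_assoc, mul_left_comm]

theorem dotProduct_mulVec_sub_eq (run : P.CFRRun R w) (t : ℕ) {z : P.Coord → ℝ}
    (hz : z ∈ P.utcPolytope) :
    w t ⬝ᵥ ((devMatrix z).mulVec (run.x t) - run.x t) = ∑ v, run.advantage z t v := by
  have hdev := run.sum_advantage t (run.dev_mem_utcPolytope t)
  rw [run.x_fixed, sum_advantage_dev] at hdev
  rw [run.sum_advantage t hz, dotProduct_sub]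
  linarith

theorem sum_advantage_le (run : P.CFRRun R w) (hw : ∀ t, P.IsUtility (w t)) {z : P.Coord → ℝ}
    (hz : z ∈ P.utcPolytope) {v : P.UDec} {ρ : ℕ → ℝ} (hρ : (R v).HasRegret ρ) (T : ℕ) :
    ∑ t ∈ range T, run.advantage z t v ≤ ρ T := by
  obtain ⟨y, hy0, -, hy1, hy⟩ := exists_eq_sum_mul_of_nonneg (univ_nonempty (α := P.Choice v))
    (z := fun i => z (choiceCoord v i)) fun i _ => hz.2.2.2 _
  rw [← hz.1 v] at hy
  have hregret : ∀ t, run.advantage z t v =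
      arrival v z * (run.gain t v ⬝ᵥ (y - (R v).next (history (fun s => run.gain s v) t))) := by
    intro t
    rw [← run.strat_eq, dotProduct_comm, sub_dotProduct, mul_sub, advantage, run.value_eq]
    simp only [dotProduct, hy _ (mem_univ _), mul_assoc, ← mul_sum]
  simp only [hregret, ← mul_sum]
  exact (mul_le_mul_of_nonneg_left
    (hρ _ (fun t i => run.gain_mem_Icc (hw t) v i) T y ⟨hy0, hy1⟩)
    (arrival_nonneg fun e _ => hz.2.2.2 e)).trans
      (mul_le_of_le_one_left (hρ.nonneg T) (arrival_le_one_of_mem_utcPolytope hz v))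

theorem regretAgainst_le (run : P.CFRRun R w) (hw : ∀ t, P.IsUtility (w t))
    {ρ : P.UDec → ℕ → ℝ} (hρ : ∀ v, (R v).HasRegret (ρ v)) {π : ℕ → P.X → ℝ}
    (hπ : ∀ t, mean (π t) = run.x t) (T : ℕ) {φ : P.Deviation}
    (hφ : ∃ z ∈ P.utcPolytope, ∀ x : P.X, φ x = (devMatrix z).mulVec x) :
    regretAgainst π w T φ ≤ ∑ v, ρ v T := by
  obtain ⟨z, hz, hφ⟩ := hφ
  simp only [regretAgainst_eq_of_eq_mulVec hφ, hπ, run.dotProduct_mulVec_sub_eq _ hz]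
  rw [sum_comm]
  exact sum_le_sum fun v _ => run.sum_advantage_le hw hz (hρ v) T

theorem phiRegretLE (run : P.CFRRun R w) (hw : ∀ t, P.IsUtility (w t)) {ρ : P.UDec → ℕ → ℝ}
    (hρ : ∀ v, (R v).HasRegret (ρ v)) {π : ℕ → P.X → ℝ} (hπ : ∀ t, mean (π t) = run.x t) (T : ℕ) :
    PhiRegretLE P.utcDeviations π w T (∑ v, ρ v T) ∧
      PhiRegretLE P.linearDeviations π w T (∑ v, ρ v T) :=
  ⟨fun _ hφ => run.regretAgainst_le hw hρ hπ T (exists_mem_utcPolytope_of_mem_utcDeviations hφ),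
    fun _ hφ => run.regretAgainst_le hw hρ hπ T (exists_mem_utcPolytope_of_linearDeviation hφ)⟩

end CFRRun

theorem PhiRegretLE.mono {Φ : Set P.Deviation} {π : ℕ → P.X → ℝ} {w : ℕ → P.Seq → ℝ} {T : ℕ}
    {r r' : ℝ} (h : PhiRegretLE Φ π w T r) (hr : r ≤ r') : PhiRegretLE Φ π w T r' :=
  fun φ hφ => (h φ hφ).trans hr

theorem sum_le_two_mul_size_sq {ρ : P.UDec → ℝ} {C s : ℝ} (hC : 0 ≤ C) (hs : 0 ≤ s)
    (h : ∀ v, ρ v ≤ C * Fintype.card (P.Choice v) * s) :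
    ∑ v, ρ v ≤ 2 * C * (P.size : ℝ) ^ 2 * s := by
  have hcard : ∑ v : P.UDec, (Fintype.card (P.Choice v) : ℝ) ≤ 2 * (P.size : ℝ) ^ 2 := by
    exact_mod_cast sum_card_choice_le (P := P)
  calc ∑ v, ρ v ≤ ∑ v : P.UDec, C * Fintype.card (P.Choice v) * s := sum_le_sum fun v _ => h v
    _ = C * (∑ v : P.UDec, (Fintype.card (P.Choice v) : ℝ)) * s := by rw [← sum_mul, ← mul_sum]
    _ ≤ C * (2 * (P.size : ℝ) ^ 2) * s := by gcongr
    _ = 2 * C * (P.size : ℝ) ^ 2 * s := by ring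

end Regret

end TreeFormDecisionProblem

/-! ### Straight-line programs -/

namespace TreeFormDecisionProblem

section Machine

variable {P : TreeFormDecisionProblem.{u}} {R : ∀ v : P.UDec, LocalMinimizer (P.Choice v)}
  {fixpt : Matrix P.Seq P.Seq ℝ → P.Seq → ℝ}

theorem runProg_append (p q : List P.Instr) (s : P.MachineState) :
    runProg R fixpt (p ++ q) s = runProg R fixpt q (runProg R fixpt p s) :=
  List.foldl_append

theorem runProg_cons (i : P.Instr) (p : List P.Instr) (s : P.MachineState) :
    runProg R fixpt (i :: p) s = runProg R fixpt p (i.exec R fixpt s) := rfl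

theorem progCost_append (f : ℕ) (ca ct : P.UDec → ℕ) (p q : List P.Instr) :
    progCost f ca ct (p ++ q) = progCost f ca ct p + progCost f ca ct q := by
  simp only [progCost, List.map_append, List.sum_append]

theorem progCost_cons (f : ℕ) (ca ct : P.UDec → ℕ) (i : P.Instr) (p : List P.Instr) :
    progCost f ca ct (i :: p) = i.cost f ca ct + progCost f ca ct p := by
  simp only [progCost, List.map_cons, List.sum_cons]

theorem progCost_flatMap {ι : Type*} (f : ℕ) (ca ct : P.UDec → ℕ) (l : List ι)
    (p : ι → List P.Instr) :
    progCost f ca ct (l.flatMap p) = (l.map fun i => progCost f ca ct (p i)).sum := by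
  induction l with
  | nil => rfl
  | cons i l ih => rw [List.flatMap_cons, progCost_append, ih, List.map_cons, List.sum_cons]

/-- The register for intermediate results within one assignment. -/
abbrev scratch : P.Register := .work 0

/-- The register that holds the constant `1`, so that a sum can be written as a sum of products. -/
abbrev unitReg : P.Register := .work 1

/-- The register `r` occurs in one of the products listed in `args`. -/
def Reads (args : List (P.Register × P.Register)) (r : P.Register) : Prop :=
  ∃ p ∈ args, r = p.1 ∨ r = p.2

@[simp]
theorem reads_nil (r : P.Register) : ¬ Reads [] r := by simp [Reads]

@[simp]
theorem reads_cons (p : P.Register × P.Register) (args : List (P.Register × P.Register))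
    (r : P.Register) : Reads (p :: args) r ↔ (r = p.1 ∨ r = p.2) ∨ Reads args r := by
  simp [Reads]

@[simp]
theorem reads_map {ι : Type*} (l : List ι) (f : ι → P.Register × P.Register) (r : P.Register) :
    Reads (l.map f) r ↔ ∃ i ∈ l, r = (f i).1 ∨ r = (f i).2 := by
  simp [Reads]

namespace MachineState

variable {s s₁ s₂ : P.MachineState} {dst : P.Register} {c c' : ℝ}
  {args : List (P.Register × P.Register)}

@[simp]
theorem mem_store_self (s : P.MachineState) (r : P.Register) (c : ℝ) :
    (s.store r c).mem r = c := by
  simp [store]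

theorem mem_store_of_ne (s : P.MachineState) {r r' : P.Register} (h : r' ≠ r) (c : ℝ) :
    (s.store r c).mem r' = s.mem r' := by
  simp [store, h]

/-- The sum of the products of the contents of the pairs of registers in `args`. -/
def eval (s : P.MachineState) (args : List (P.Register × P.Register)) : ℝ :=
  (args.map fun p => s.mem p.1 * s.mem p.2).sum

@[simp]
theorem eval_nil (s : P.MachineState) : s.eval [] = 0 := rfl

@[simp]
theorem eval_cons (s : P.MachineState) (p : P.Register × P.Register)
    (args : List (P.Register × P.Register)) :
    s.eval (p :: args) = s.mem p.1 * s.mem p.2 + s.eval args := by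
  simp only [eval, List.map_cons, List.sum_cons]

theorem eval_map_toList {ι : Type*} [Fintype ι] (s : P.MachineState)
    (f : ι → P.Register × P.Register) :
    s.eval (univ.toList.map f) = ∑ i, s.mem (f i).1 * s.mem (f i).2 := by
  rw [eval, List.map_map, ← sum_map_toList]
  rfl

theorem eval_congr (h : ∀ r, Reads args r → s.mem r = s₁.mem r) : s.eval args = s₁.eval args :=
  congrArg List.sum <| List.map_congr_left fun p hp =>
    congrArg₂ _ (h _ ⟨p, hp, .inl rfl⟩) (h _ ⟨p, hp, .inr rfl⟩)

/-- The state `s₁` arises from `s` by writing `c` to `dst`; the content of `scratch` may change. -/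
structure Writes (s s₁ : P.MachineState) (dst : P.Register) (c : ℝ) : Prop where
  hist : s₁.hist = s.hist
  mem_self : s₁.mem dst = c
  mem_of_ne : ∀ r, r ≠ dst → r ≠ scratch → s₁.mem r = s.mem r

theorem writes_store (s : P.MachineState) (dst : P.Register) (c : ℝ) :
    s.Writes (s.store dst c) dst c :=
  ⟨rfl, mem_store_self _ _ _, fun _ hr _ => mem_store_of_ne _ hr _⟩

theorem Writes.trans (h : s.Writes s₁ dst c) (h' : s₁.Writes s₂ dst c') : s.Writes s₂ dst c' :=
  ⟨h'.hist.trans h.hist, h'.mem_self,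
    fun r hr hr' => (h'.mem_of_ne r hr hr').trans (h.mem_of_ne r hr hr')⟩

theorem Writes.eval_eq (h : s.Writes s₁ dst c) (hdst : ¬ Reads args dst)
    (hscratch : ¬ Reads args scratch) : s₁.eval args = s.eval args :=
  eval_congr fun r hr => h.mem_of_ne r (fun h => hdst (h ▸ hr)) fun h => hscratch (h ▸ hr)

end MachineState

/-- Add the products listed in `args` to the content of `dst`. -/
def addProducts (dst : P.Register) (args : List (P.Register × P.Register)) : List P.Instr :=
  args.flatMap fun p => [.mul scratch p.1 p.2, .add dst dst scratch]

/-- Compute the sum of the products listed in `args` in `dst`. -/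
def assign (dst : P.Register) (args : List (P.Register × P.Register)) : List P.Instr :=
  .const dst 0 :: addProducts dst args

section Assign

variable {dst : P.Register} {args : List (P.Register × P.Register)}

theorem writes_runProg_addProducts (hne : dst ≠ scratch) (hdst : ¬ Reads args dst)
    (hscratch : ¬ Reads args scratch) (s : P.MachineState) :
    s.Writes (runProg R fixpt (addProducts dst args) s) dst (s.mem dst + s.eval args) := by
  induction args generalizing s with
  | nil => exact ⟨rfl, (add_zero _).symm, fun _ _ _ => rfl⟩
  | cons p args ih =>
    obtain ⟨-, hdst'⟩ := not_or.1 (mt (reads_cons _ _ _).2 hdst)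
    obtain ⟨-, hscratch'⟩ := not_or.1 (mt (reads_cons _ _ _).2 hscratch)
    set s₁ := s.store scratch (s.mem p.1 * s.mem p.2)
    set s₂ := s₁.store dst (s₁.mem dst + s₁.mem scratch)
    have hstep : s.Writes s₂ dst (s.mem dst + s.mem p.1 * s.mem p.2) := by
      refine ⟨rfl, ?_, fun r hr hr' => ?_⟩
      · rw [MachineState.mem_store_self, MachineState.mem_store_self,
          MachineState.mem_store_of_ne _ hne]
      · rw [MachineState.mem_store_of_ne _ hr, MachineState.mem_store_of_ne _ hr']
    have hrest := ih hdst' hscratch' s₂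
    rw [hstep.mem_self, hstep.eval_eq hdst' hscratch', add_assoc, ← MachineState.eval_cons] at hrest
    exact hstep.trans hrest

theorem writes_runProg_assign (hne : dst ≠ scratch) (hdst : ¬ Reads args dst)
    (hscratch : ¬ Reads args scratch) (s : P.MachineState) :
    s.Writes (runProg R fixpt (assign dst args) s) dst (s.eval args) := by
  have hzero := s.writes_store dst (0 : ℕ)
  have hsum := writes_runProg_addProducts (R := R) (fixpt := fixpt) hne hdst hscratch
    (s.store dst (0 : ℕ))
  rw [hzero.mem_self, hzero.eval_eq hdst hscratch] at hsum
  rw [← zero_add (s.eval args), ← Nat.cast_zero]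
  exact hzero.trans hsum

end Assign

theorem progCost_assign (f : ℕ) (ca ct : P.UDec → ℕ) (dst : P.Register)
    (args : List (P.Register × P.Register)) :
    progCost f ca ct (assign dst args) = 1 + 2 * args.length := by
  have hpair : ∀ p : P.Register × P.Register,
      progCost f ca ct [.mul scratch p.1 p.2, .add dst dst scratch] = 2 := fun _ => rfl
  simp only [assign, addProducts, progCost_cons, progCost_flatMap, hpair, List.map_const',
    List.sum_replicate, smul_eq_mul, Instr.cost, mul_comm]

/-- A system of assignments `dst i := ∑ a * b`, over the pairs of registers `(a, b)` in `args i`,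
that can be carried out in the order of increasing `rank`. -/
structure Schedule (P : TreeFormDecisionProblem.{u}) (ι : Type*) where
  dst : ι → P.Register
  args : ι → List (P.Register × P.Register)
  rank : ι → ℤ
  dst_injective : Function.Injective dst
  dst_ne_scratch : ∀ i, dst i ≠ scratch
  dst_ne_unitReg : ∀ i, dst i ≠ unitReg
  not_reads_scratch : ∀ i, ¬ Reads (args i) scratch
  rank_lt : ∀ i i', Reads (args i) (dst i') → rank i' < rank i

namespace Schedule

variable {ι : Type*} (S : P.Schedule ι) {D : Set ι} {s s₁ : P.MachineState}

/-- The state `s₁` arises from `s` by carrying out the assignments with indices in `D`, and it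
satisfies them as equations; the content of `scratch` may change. -/
structure Solves (D : Set ι) (s s₁ : P.MachineState) : Prop where
  hist : s₁.hist = s.hist
  mem_dst : ∀ i ∈ D, s₁.mem (S.dst i) = s₁.eval (S.args i)
  mem_of_ne : ∀ r, (∀ i ∈ D, r ≠ S.dst i) → r ≠ scratch → s₁.mem r = s.mem r

variable {S}

theorem not_reads_dst {i j : ι} (h : S.rank i ≤ S.rank j) : ¬ Reads (S.args i) (S.dst j) :=
  fun hread => (S.rank_lt i j hread).not_ge h

theorem Solves.insert_assign (h : S.Solves D s s₁) {j : ι} (hj : j ∉ D)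
    (hrank : ∀ i ∈ D, S.rank i ≤ S.rank j) :
    S.Solves (insert j D) s (runProg R fixpt (assign (S.dst j) (S.args j)) s₁) := by
  have hw := writes_runProg_assign (R := R) (fixpt := fixpt) (S.dst_ne_scratch j)
    (not_reads_dst le_rfl) (S.not_reads_scratch j) s₁
  refine ⟨hw.hist.trans h.hist, ?_, fun r hr hr' => ?_⟩
  · rintro i (rfl | hi)
    · rw [hw.mem_self, hw.eval_eq (not_reads_dst le_rfl) (S.not_reads_scratch i)]
    · have hij : S.dst i ≠ S.dst j := S.dst_injective.ne fun hij => hj (hij ▸ hi)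
      rw [hw.mem_of_ne _ hij (S.dst_ne_scratch i), h.mem_dst i hi,
        hw.eval_eq (not_reads_dst (hrank i hi)) (S.not_reads_scratch i)]
  · rw [hw.mem_of_ne r (hr j (.inl rfl)) hr', h.mem_of_ne r (fun i hi => hr i (.inr hi)) hr']

theorem solves_runProg_flatMap_assign {l : List ι} (hnodup : l.Nodup)
    (hrank : l.Pairwise fun i j => S.rank i ≤ S.rank j) (s : P.MachineState) :
    S.Solves {i | i ∈ l} s
      (runProg R fixpt (l.flatMap fun i => assign (S.dst i) (S.args i)) s) := by
  induction l using List.reverseRecOn with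
  | nil => exact ⟨rfl, by simp, fun _ _ _ => rfl⟩
  | append_singleton l j ih =>
    obtain ⟨hl, -, hlj⟩ := List.nodup_append.1 hnodup
    obtain ⟨hrank, -, hrankj⟩ := List.pairwise_append.1 hrank
    have hset : {i | i ∈ l ++ [j]} = insert j {i | i ∈ l} := by
      ext i
      simp [or_comm]
    rw [hset, List.flatMap_append, runProg_append, List.flatMap_singleton]
    exact (ih hl hrank).insert_assign (fun hj => hlj j hj j (by simp) rfl)
      fun i hi => hrankj i hi j (by simp)

variable [Fintype ι] (S)

/-- The indices of a schedule in an order in which the assignments can be carried out. -/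
noncomputable def order : List ι := (exists_perm_toList_pairwise_le S.rank).choose

theorem order_perm : S.order.Perm univ.toList :=
  (exists_perm_toList_pairwise_le S.rank).choose_spec.1

theorem order_pairwise : S.order.Pairwise fun i j => S.rank i ≤ S.rank j :=
  (exists_perm_toList_pairwise_le S.rank).choose_spec.2

/-- Provide the constant `1` and carry out all assignments. -/
noncomputable def program : List P.Instr :=
  .const unitReg 1 :: S.order.flatMap fun i => assign (S.dst i) (S.args i)

theorem solves_runProg_program (s : P.MachineState) :
    S.Solves Set.univ (s.store unitReg 1) (runProg R fixpt S.program s) := by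
  have huniv : {i | i ∈ S.order} = Set.univ :=
    Set.eq_univ_of_forall fun i => S.order_perm.mem_iff.2 (mem_toList.2 (mem_univ i))
  rw [← huniv, ← Nat.cast_one]
  exact solves_runProg_flatMap_assign (S.order_perm.nodup_iff.2 (nodup_toList _)) S.order_pairwise _

theorem hist_runProg_program (s : P.MachineState) :
    (runProg R fixpt S.program s).hist = s.hist :=
  (S.solves_runProg_program s).hist

theorem mem_dst_runProg_program (s : P.MachineState) (i : ι) :
    (runProg R fixpt S.program s).mem (S.dst i) =
      (runProg R fixpt S.program s).eval (S.args i) :=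
  (S.solves_runProg_program s).mem_dst i trivial

theorem mem_unitReg_runProg_program (s : P.MachineState) :
    (runProg R fixpt S.program s).mem unitReg = 1 := by
  rw [(S.solves_runProg_program s).mem_of_ne _ (fun i _ => (S.dst_ne_unitReg i).symm) (by simp),
    MachineState.mem_store_self]

theorem mem_runProg_program_of_ne (s : P.MachineState) {r : P.Register} (hdst : ∀ i, r ≠ S.dst i)
    (hscratch : r ≠ scratch) (hunit : r ≠ unitReg) :
    (runProg R fixpt S.program s).mem r = s.mem r := by
  rw [(S.solves_runProg_program s).mem_of_ne r (fun i _ => hdst i) hscratch,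
    MachineState.mem_store_of_ne _ hunit]

theorem progCost_program (f : ℕ) (ca ct : P.UDec → ℕ) :
    progCost f ca ct S.program = 1 + ∑ i, (1 + 2 * (S.args i).length) := by
  simp only [program, progCost_cons, progCost_flatMap, progCost_assign, Instr.cost]
  rw [(S.order_perm.map _).sum_eq, sum_map_toList]

end Schedule

theorem hist_runProg_ask (l : List P.UDec) (s : P.MachineState) :
    (runProg R fixpt (l.map .ask) s).hist = s.hist := by
  induction l generalizing s with
  | nil => rfl
  | cons _ _ ih => exact ih _

theorem mem_strat_runProg_ask {l : List P.UDec} (s : P.MachineState) {v : P.UDec} (hv : v ∈ l)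
    (i : P.Choice v) :
    (runProg R fixpt (l.map .ask) s).mem (.strat v i) = (R v).next (s.hist v) i := by
  induction l using List.reverseRecOn with
  | nil => exact absurd hv List.not_mem_nil
  | append_singleton l u ih =>
    rw [List.map_append, runProg_append]
    change (if v = u then (R v).next ((runProg R fixpt (l.map .ask) s).hist v) i
      else (runProg R fixpt (l.map .ask) s).mem (.strat v i)) = _
    split_ifs with h
    · rw [hist_runProg_ask]
    · exact ih (by simpa [h] using hv)

theorem mem_runProg_tell (l : List P.UDec) (s : P.MachineState) :
    (runProg R fixpt (l.map .tell) s).mem = s.mem := by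
  induction l generalizing s with
  | nil => rfl
  | cons _ _ ih => exact ih _

theorem hist_runProg_tell {l : List P.UDec} (hnodup : l.Nodup) (s : P.MachineState) (v : P.UDec) :
    (runProg R fixpt (l.map .tell) s).hist v =
      if v ∈ l then s.hist v ++ [fun i => s.mem (.gain v i)] else s.hist v := by
  induction l generalizing s with
  | nil => rfl
  | cons u l ih =>
    obtain ⟨hu, hl⟩ := List.nodup_cons.1 hnodup
    rw [List.map_cons, runProg_cons, ih hl]
    by_cases hv : v = u
    · subst hv
      simp [Instr.exec, hu]
    · simp [Instr.exec, hv]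

theorem progCost_ask (f : ℕ) (ca ct : P.UDec → ℕ) :
    progCost f ca ct ((univ : Finset P.UDec).toList.map .ask) =
      ∑ v : P.UDec, Fintype.card (P.Choice v) + ∑ v, ca v := by
  rw [progCost, List.map_map, ← sum_add_distrib, ← sum_map_toList]
  rfl

theorem progCost_tell (f : ℕ) (ca ct : P.UDec → ℕ) :
    progCost f ca ct ((univ : Finset P.UDec).toList.map .tell) =
      ∑ v : P.UDec, Fintype.card (P.Choice v) + ∑ v, ct v := by
  rw [progCost, List.map_map, ← sum_add_distrib, ← sum_map_toList]
  rfl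

end Machine

end TreeFormDecisionProblem

/-! ### An iteration as a straight-line program -/

namespace TreeFormDecisionProblem

section Passes

variable {P : TreeFormDecisionProblem.{u}}

/-- The work register of an intermediate result: an entry of the matrix `B`, a mass that arrives at
a decision point, or a counterfactual value. The registers `scratch` and `unitReg` are skipped. -/
noncomputable def workReg (e : (P.Dec × P.Dec) ⊕ P.UDec ⊕ P.UDec) : P.Register :=
  .work (Fintype.equivFin _ e + 2)

/-- The register of a coordinate of the pair `(A, B)`: the matrix `A` is stored at the input port of
the fixed-point oracle. -/
noncomputable def coordReg : P.Coord → P.Register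
  | .inl (σ, τ) => .matrix σ τ
  | .inr e => workReg (.inl e)

/-- The register of the mass that arrives at a decision point. -/
noncomputable def arrivalReg (v : P.UDec) : P.Register := workReg (.inr (.inl v))

/-- The register of a counterfactual value. -/
noncomputable def valueReg (v : P.UDec) : P.Register := workReg (.inr (.inr v))

attribute [local simp] workReg coordReg arrivalReg valueReg Fin.val_inj

theorem sumElim_coordReg_arrivalReg_injective :
    Function.Injective (Sum.elim coordReg arrivalReg : P.Coord ⊕ P.UDec → P.Register) := by
  rintro ((⟨σ, τ⟩ | e) | v) ((⟨σ', τ'⟩ | e') | v') h <;> simp_all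

theorem sumElim_gain_valueReg_injective : Function.Injective
    (Sum.elim (fun c => .gain c.1 c.2) valueReg :
      (Σ v : P.UDec, P.Choice v) ⊕ P.UDec → P.Register) := by
  rintro (⟨v, i⟩ | v) (⟨v', i'⟩ | v') h <;> simp_all

/-- The products that sum up to a coordinate of `(A, B)` or to an arriving mass. -/
noncomputable def forwardArgs : P.Coord ⊕ P.UDec → List (P.Register × P.Register)
  | .inl (.inl (none, τ)) => if τ = none then [(unitReg, unitReg)] else []
  | .inl (.inl (some ⟨j, a⟩, τ)) => [(.strat (j, τ) (.inl a), arrivalReg (j, τ))]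
  | .inl (.inr (j, k)) =>
      [(.strat (j, P.parent k) (.inr ⟨k, rfl⟩), arrivalReg (j, P.parent k))]
  | .inr (j, none) => [(coordReg (.inl (P.parent j, none)), unitReg)]
  | .inr (j, some ⟨k, a⟩) =>
      [(coordReg (.inl (P.parent j, some ⟨k, a⟩)), unitReg), (coordReg (.inr (j, k)), unitReg)]

theorem forwardArgs_choice (v : P.UDec) (i : P.Choice v) :
    forwardArgs (.inl (choiceCoord v i)) = [(.strat v i, arrivalReg v)] := by
  obtain ⟨j, τ⟩ := v
  rcases i with a | ⟨k, (rfl : P.parent k = τ)⟩ <;> rfl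

theorem eq_unitReg_of_reads_forwardArgs_root {τ : P.Seq} {r : P.Register}
    (h : Reads (forwardArgs (.inl (.inl (P.root, τ)))) r) : r = unitReg := by
  simp only [forwardArgs] at h
  split_ifs at h
  · simpa only [reads_cons, reads_nil, or_false, or_self] using h
  · exact (reads_nil r h).elim

theorem exists_feeds_of_reads_forwardArgs_arrival {v : P.UDec} {r : P.Register}
    (h : Reads (forwardArgs (.inr v)) r) : r = unitReg ∨ ∃ e, Feeds e v ∧ r = coordReg e := by
  obtain ⟨j, _ | ⟨k, a⟩⟩ := v <;>
    simp only [forwardArgs, reads_cons, reads_nil, or_false] at h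
  · exact h.symm.imp_right fun h => ⟨_, .observe j _, h⟩
  · rcases h with (h | h) | h | h
    exacts [.inr ⟨_, .observe j _, h⟩, .inl h, .inr ⟨_, .reply j k a, h⟩, .inl h]

/-- The order of computation in the forward pass: nodes closer to the root come first. -/
noncomputable def forwardRank : P.Coord ⊕ P.UDec → ℤ :=
  Sum.elim (fun e => 2 * P.coordDepth e) fun v => 2 * P.decDepth v + 1

theorem forwardRank_lt_of_reads {i : P.Coord ⊕ P.UDec} {r : P.Register}
    (h : Reads (forwardArgs i) r) :
    r = unitReg ∨ (∃ v c, r = .strat v c) ∨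
      ∃ i', r = Sum.elim coordReg arrivalReg i' ∧ forwardRank i' < forwardRank i := by
  rcases i with e | v
  · obtain ⟨τ, rfl⟩ | ⟨v, c, rfl⟩ := eq_root_or_exists_choiceCoord e
    · exact .inl (eq_unitReg_of_reads_forwardArgs_root h)
    · rw [forwardArgs_choice] at h
      obtain h | h := by simpa only [reads_cons, reads_nil, or_false] using h
      · exact .inr (.inl ⟨v, c, h⟩)
      · refine .inr (.inr ⟨.inr v, h, ?_⟩)
        simp only [forwardRank, Sum.elim_inl, Sum.elim_inr, coordDepth_choiceCoord]
        omega
  · refine (exists_feeds_of_reads_forwardArgs_arrival h).imp_right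
      fun ⟨e, he, h⟩ => .inr ⟨.inl e, h, ?_⟩
    simp only [forwardRank, Sum.elim_inl, Sum.elim_inr, he.coordDepth_eq]
    omega

variable (P) in
/-- The forward pass: from the local strategies to `(A, B)`. -/
noncomputable def forwardPass : P.Schedule (P.Coord ⊕ P.UDec) where
  dst := Sum.elim coordReg arrivalReg
  args := forwardArgs
  rank := forwardRank
  dst_injective := sumElim_coordReg_arrivalReg_injective
  dst_ne_scratch := by rintro ((⟨σ, τ⟩ | e) | v) <;> simp
  dst_ne_unitReg := by rintro ((⟨σ, τ⟩ | e) | v) <;> simp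
  not_reads_scratch i h := by
    obtain h | ⟨v, c, h⟩ | ⟨(⟨σ, τ⟩ | e) | v, h, -⟩ := forwardRank_lt_of_reads h <;> simp at h
  rank_lt i i' h := by
    obtain h | ⟨v, c, h⟩ | ⟨i'', h, hlt⟩ := forwardRank_lt_of_reads h
    · obtain (⟨σ, τ⟩ | e) | v := i' <;> simp at h
    · obtain (⟨σ, τ⟩ | e) | v := i' <;> simp at h
    · rwa [sumElim_coordReg_arrivalReg_injective h]

/-- The products that sum up to a counterfactual utility or to a counterfactual value. -/
noncomputable def backwardArgs :
    (Σ v : P.UDec, P.Choice v) ⊕ P.UDec → List (P.Register × P.Register)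
  | .inl ⟨(j, τ), .inl a⟩ => (.utility (P.child j a), .play τ) ::
      (univ : Finset (P.Next (P.child j a))).toList.map fun k => (valueReg (k.1, τ), unitReg)
  | .inl ⟨(j, _), .inr k⟩ =>
      (univ : Finset (P.Act k.1)).toList.map fun a => (valueReg (j, P.child k.1 a), unitReg)
  | .inr v => (univ : Finset (P.Choice v)).toList.map fun i => (.strat v i, .gain v i)

theorem exists_decDepth_eq_of_reads_backwardArgs_gain {v : P.UDec} {i : P.Choice v} {r : P.Register}
    (h : Reads (backwardArgs (.inl ⟨v, i⟩)) r) :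
    r = unitReg ∨ (∃ σ, r = .utility σ) ∨ (∃ τ, r = .play τ) ∨
      ∃ u, P.decDepth u = P.decDepth v + 1 ∧ r = valueReg u := by
  obtain ⟨j, τ⟩ := v
  rcases i with a | ⟨k, (rfl : P.parent k = τ)⟩
  · simp only [backwardArgs, reads_cons, reads_map] at h
    obtain (h | h) | ⟨⟨k, hk⟩, -, h | h⟩ := h
    · exact .inr (.inl ⟨_, h⟩)
    · exact .inr (.inr (.inl ⟨_, h⟩))
    · refine .inr (.inr (.inr ⟨_, ?_, h⟩))
      simp only [decDepth, ← seqDepth_parent, show P.parent k = _ from hk, seqDepth_child]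
      omega
    · exact .inl h
  · simp only [backwardArgs, reads_map] at h
    obtain ⟨a, -, h | h⟩ := h
    · refine .inr (.inr (.inr ⟨_, ?_, h⟩))
      simp only [decDepth, seqDepth_parent, seqDepth_child]
      omega
    · exact .inl h

/-- The order of computation in the backward pass: nodes farther from the root come first. -/
noncomputable def backwardRank : (Σ v : P.UDec, P.Choice v) ⊕ P.UDec → ℤ :=
  Sum.elim (fun c => -2 * P.decDepth c.1 - 1) fun v => -2 * P.decDepth v

theorem backwardRank_lt_of_reads {i : (Σ v : P.UDec, P.Choice v) ⊕ P.UDec} {r : P.Register}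
    (h : Reads (backwardArgs i) r) :
    r = unitReg ∨ (∃ σ, r = .utility σ) ∨ (∃ τ, r = .play τ) ∨ (∃ v c, r = .strat v c) ∨
      ∃ i', r = Sum.elim (fun c => .gain c.1 c.2) valueReg i' ∧
        backwardRank i' < backwardRank i := by
  rcases i with ⟨v, c⟩ | v
  · obtain h | h | h | ⟨u, hu, h⟩ := exists_decDepth_eq_of_reads_backwardArgs_gain h
    · exact .inl h
    · exact .inr (.inl h)
    · exact .inr (.inr (.inl h))
    · refine .inr (.inr (.inr (.inr ⟨.inr u, h, ?_⟩)))
      simp only [backwardRank, Sum.elim_inl, Sum.elim_inr, hu]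
      omega
  · simp only [backwardArgs, reads_map] at h
    obtain ⟨c, -, h | h⟩ := h
    · exact .inr (.inr (.inr (.inl ⟨v, c, h⟩)))
    · refine .inr (.inr (.inr (.inr ⟨.inl ⟨v, c⟩, h, ?_⟩)))
      simp only [backwardRank, Sum.elim_inl, Sum.elim_inr]
      omega

variable (P) in
/-- The backward pass: counterfactual utilities and values. -/
noncomputable def backwardPass : P.Schedule ((Σ v : P.UDec, P.Choice v) ⊕ P.UDec) where
  dst := Sum.elim (fun c => .gain c.1 c.2) valueReg
  args := backwardArgs
  rank := backwardRank
  dst_injective := sumElim_gain_valueReg_injective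
  dst_ne_scratch := by rintro (⟨v, c⟩ | v) <;> simp
  dst_ne_unitReg := by rintro (⟨v, c⟩ | v) <;> simp
  not_reads_scratch i h := by
    obtain h | ⟨σ, h⟩ | ⟨τ, h⟩ | ⟨v, c, h⟩ | ⟨⟨v, c⟩ | v, h, -⟩ := backwardRank_lt_of_reads h <;>
      simp at h
  rank_lt i i' h := by
    obtain h | ⟨σ, h⟩ | ⟨τ, h⟩ | ⟨v, c, h⟩ | ⟨i'', h, hlt⟩ := backwardRank_lt_of_reads h
    · obtain ⟨v', c'⟩ | v' := i' <;> simp at h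
    · obtain ⟨v', c'⟩ | v' := i' <;> simp at h
    · obtain ⟨v', c'⟩ | v' := i' <;> simp at h
    · obtain ⟨v', c'⟩ | v' := i' <;> simp at h
    · rwa [sumElim_gain_valueReg_injective h]

theorem sum_sigma_choice {M : Type*} [AddCommMonoid M] (f : (Σ v : P.UDec, P.Choice v) → M) :
    ∑ c, f c = ∑ j, ∑ τ, ∑ a, f ⟨(j, τ), .inl a⟩ + ∑ j, ∑ τ, ∑ k, f ⟨(j, τ), .inr k⟩ := by
  simp only [Fintype.sum_sigma, Fintype.sum_prod_type, Fintype.sum_sum_type, sum_add_distrib]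

theorem sum_cost_forwardPass_le :
    ∑ i, (1 + 2 * (P.forwardPass.args i).length) ≤ 11 * P.size ^ 2 := by
  have hcoord : ∀ e : P.Coord, 1 + 2 * (forwardArgs (.inl e)).length ≤ 3 := by
    intro e
    obtain ⟨τ, rfl⟩ | ⟨v, i, rfl⟩ := eq_root_or_exists_choiceCoord e
    · simp only [forwardArgs]
      split_ifs <;> simp
    · simp [forwardArgs_choice]
  have harrival : ∀ v : P.UDec, 1 + 2 * (forwardArgs (.inr v)).length ≤ 5 := by
    rintro ⟨j, _ | ⟨k, a⟩⟩ <;> simp [forwardArgs]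
  rw [Fintype.sum_sum_type]
  refine (add_le_add (sum_le_sum fun e _ => hcoord e) (sum_le_sum fun v _ => harrival v)).trans ?_
  simp only [sum_const, card_univ, smul_eq_mul, Fintype.card_sum, Fintype.card_prod]
  change (P.size * P.size + _) * 3 + Fintype.card P.Dec * P.size * 5 ≤ _
  nlinarith [card_dec_lt_size (P := P)]

theorem sum_cost_backwardArgs_play_le :
    ∑ j, ∑ τ, ∑ a, (1 + 2 * (backwardArgs (P := P) (.inl ⟨(j, τ), .inl a⟩)).length) ≤
      5 * P.size ^ 2 := by
  have hnext : ∑ j, ∑ a, Fintype.card (P.Next (P.child j a)) ≤ Fintype.card P.Dec := by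
    rw [← sum_card_next, sum_seq]
    exact Nat.le_add_left _ _
  have hrow : ∀ j (τ : P.Seq),
      ∑ a, (1 + 2 * (backwardArgs (P := P) (.inl ⟨(j, τ), .inl a⟩)).length) =
        3 * Fintype.card (P.Act j) + 2 * ∑ a, Fintype.card (P.Next (P.child j a)) := by
    intro j τ
    simp only [backwardArgs, List.length_cons, List.length_map, length_toList, card_univ,
      mul_add, sum_add_distrib, sum_const, smul_eq_mul, mul_one, ← mul_sum]
    ring
  rw [sum_comm]
  simp only [hrow, sum_const, card_univ, smul_eq_mul, sum_add_distrib, ← mul_sum]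
  change P.size * _ ≤ _
  nlinarith [card_dec_lt_size (P := P), sum_card_act (P := P)]

theorem sum_cost_backwardArgs_query_le :
    ∑ j, ∑ τ, ∑ k : P.Next τ, (1 + 2 * (backwardArgs (P := P) (.inl ⟨(j, τ), .inr k⟩)).length) ≤
      3 * P.size ^ 2 := by
  have hrow : ∀ j, ∑ τ, ∑ k : P.Next τ,
      (1 + 2 * (backwardArgs (P := P) (.inl ⟨(j, τ), .inr k⟩)).length) =
        Fintype.card P.Dec + 2 * ∑ k, Fintype.card (P.Act k) := by
    intro j
    simp only [backwardArgs, List.length_map, length_toList, card_univ]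
    rw [sum_next fun _ k => 1 + 2 * Fintype.card (P.Act k)]
    simp [sum_add_distrib, mul_sum]
  simp only [hrow, sum_const, card_univ, smul_eq_mul]
  nlinarith [card_dec_lt_size (P := P), sum_card_act (P := P)]

theorem sum_cost_backwardArgs_value_le :
    ∑ v : P.UDec, (1 + 2 * (backwardArgs (.inr v)).length) ≤ 5 * P.size ^ 2 := by
  simp only [backwardArgs, List.length_map, length_toList, card_univ, sum_add_distrib,
    ← mul_sum, sum_const, Fintype.card_prod, smul_eq_mul, mul_one]
  change Fintype.card P.Dec * P.size + _ ≤ _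
  nlinarith [card_dec_lt_size (P := P), sum_card_choice_le (P := P)]

theorem sum_cost_backwardPass_le :
    ∑ i, (1 + 2 * (P.backwardPass.args i).length) ≤ 13 * P.size ^ 2 := by
  rw [Fintype.sum_sum_type, sum_sigma_choice]
  refine (add_le_add (add_le_add sum_cost_backwardArgs_play_le sum_cost_backwardArgs_query_le)
    sum_cost_backwardArgs_value_le).trans_eq ?_
  ring

end Passes

end TreeFormDecisionProblem

namespace TreeFormDecisionProblem

section Iteration

variable {P : TreeFormDecisionProblem.{u}} {R : ∀ v : P.UDec, LocalMinimizer (P.Choice v)}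
  {fixpt : Matrix P.Seq P.Seq ℝ → P.Seq → ℝ}

attribute [local simp] workReg coordReg arrivalReg valueReg

variable (P) in
/-- The part of an iteration that ends with the play. -/
noncomputable def playProgram : List P.Instr :=
  (univ : Finset P.UDec).toList.map .ask ++ (P.forwardPass.program ++ [.fix])

variable (P) in
/-- The part of an iteration that starts with the revealed utility vector. -/
noncomputable def updateProgram : List P.Instr :=
  P.backwardPass.program ++ (univ : Finset P.UDec).toList.map .tell

theorem generates_of_forwardPass {s : P.MachineState} (hunit : s.mem unitReg = 1)
    (h : ∀ i, s.mem (P.forwardPass.dst i) = s.eval (P.forwardPass.args i)) :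
    Generates (fun v i => s.mem (.strat v i)) fun e => s.mem (coordReg e) := by
  have harrival : ∀ v, s.mem (arrivalReg v) = arrival v fun e => s.mem (coordReg e) := by
    intro v
    refine (h (.inr v)).trans ?_
    obtain ⟨j, _ | ⟨k, a⟩⟩ := v <;>
      simp [forwardPass, forwardArgs, hunit, arrival, queryMass, -coordReg]
  refine ⟨fun τ => (h (.inl (.inl (P.root, τ)))).trans ?_,
    fun v i => (h (.inl (choiceCoord v i))).trans ?_⟩
  · rw [rootPoint_inl_root]
    simp only [forwardPass, forwardArgs]
    split_ifs
    · simp [hunit]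
    · rfl
  · simp only [forwardPass, forwardArgs_choice, MachineState.eval_cons, MachineState.eval_nil,
      add_zero, harrival]

theorem runProg_playProgram (s : P.MachineState) :
    runProg R fixpt P.playProgram s = Instr.exec R fixpt (runProg R fixpt P.forwardPass.program
      (runProg R fixpt ((univ : Finset P.UDec).toList.map .ask) s)) .fix := by
  rw [playProgram, runProg_append, runProg_append]
  rfl

theorem hist_runProg_playProgram (s : P.MachineState) :
    (runProg R fixpt P.playProgram s).hist = s.hist := by
  rw [runProg_playProgram]
  exact (P.forwardPass.hist_runProg_program _).trans (hist_runProg_ask _ s)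

theorem mem_strat_runProg_playProgram (s : P.MachineState) (v : P.UDec) (i : P.Choice v) :
    (runProg R fixpt P.playProgram s).mem (.strat v i) = (R v).next (s.hist v) i := by
  rw [runProg_playProgram]
  refine (P.forwardPass.mem_runProg_program_of_ne _ ?_ (by simp) (by simp)).trans
    (mem_strat_runProg_ask s (mem_toList.2 (mem_univ v)) i)
  rintro ((⟨σ, τ⟩ | e) | v) <;> simp [forwardPass]

theorem generates_runProg_playProgram (s : P.MachineState) :
    Generates (fun v i => (runProg R fixpt P.playProgram s).mem (.strat v i))
      fun e => (runProg R fixpt P.playProgram s).mem (coordReg e) := by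
  have hfix : ∀ (s' : P.MachineState) e,
      (Instr.exec R fixpt s' .fix).mem (coordReg e) = s'.mem (coordReg e) := by
    rintro s' (⟨σ, τ⟩ | e) <;> rfl
  simp only [runProg_playProgram, hfix]
  exact generates_of_forwardPass (P.forwardPass.mem_unitReg_runProg_program _)
    (P.forwardPass.mem_dst_runProg_program _)

theorem mem_play_runProg_playProgram (s : P.MachineState) (σ : P.Seq) :
    (runProg R fixpt P.playProgram s).mem (.play σ) =
      fixpt (devMatrix fun e => (runProg R fixpt P.playProgram s).mem (coordReg e)) σ := by
  rw [runProg_playProgram]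
  rfl

theorem mem_runProg_updateProgram (s : P.MachineState) :
    (runProg R fixpt P.updateProgram s).mem = (runProg R fixpt P.backwardPass.program s).mem := by
  rw [updateProgram, runProg_append, mem_runProg_tell]

theorem mem_runProg_updateProgram_of_ne (s : P.MachineState) {r : P.Register}
    (hgain : ∀ v i, r ≠ .gain v i) (hvalue : ∀ v, r ≠ valueReg v) (hscratch : r ≠ scratch)
    (hunit : r ≠ unitReg) : (runProg R fixpt P.updateProgram s).mem r = s.mem r := by
  rw [mem_runProg_updateProgram]
  refine P.backwardPass.mem_runProg_program_of_ne _ ?_ hscratch hunit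
  rintro (⟨v, i⟩ | v)
  exacts [hgain v i, hvalue v]

theorem hist_runProg_updateProgram (s : P.MachineState) (v : P.UDec) :
    (runProg R fixpt P.updateProgram s).hist v =
      s.hist v ++ [fun i => (runProg R fixpt P.updateProgram s).mem (.gain v i)] := by
  rw [mem_runProg_updateProgram, updateProgram, runProg_append,
    hist_runProg_tell (nodup_toList _), if_pos (mem_toList.2 (mem_univ v)),
    P.backwardPass.hist_runProg_program]

theorem mem_gain_play_runProg_updateProgram (s : P.MachineState) (j : P.Dec) (τ : P.Seq)
    (a : P.Act j) :
    (runProg R fixpt P.updateProgram s).mem (.gain (j, τ) (.inl a)) =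
      s.mem (.utility (P.child j a)) * s.mem (.play τ) +
        ∑ k : P.Next (P.child j a),
          (runProg R fixpt P.updateProgram s).mem (valueReg (k.1, τ)) := by
  rw [← mem_runProg_updateProgram_of_ne (R := R) (fixpt := fixpt) s (r := .utility _)
      (by simp) (by simp) (by simp) (by simp),
    ← mem_runProg_updateProgram_of_ne (R := R) (fixpt := fixpt) s (r := .play _)
      (by simp) (by simp) (by simp) (by simp), mem_runProg_updateProgram]
  refine (P.backwardPass.mem_dst_runProg_program s (.inl ⟨(j, τ), .inl a⟩)).trans ?_
  change (runProg _ _ _ s).eval (backwardArgs (.inl ⟨(j, τ), .inl a⟩)) = _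
  simp only [backwardArgs, MachineState.eval_cons, MachineState.eval_map_toList,
    P.backwardPass.mem_unitReg_runProg_program, mul_one]

theorem mem_gain_query_runProg_updateProgram (s : P.MachineState) (j : P.Dec) (τ : P.Seq)
    (k : P.Next τ) :
    (runProg R fixpt P.updateProgram s).mem (.gain (j, τ) (.inr k)) =
      ∑ a : P.Act k.1, (runProg R fixpt P.updateProgram s).mem (valueReg (j, P.child k.1 a)) := by
  rw [mem_runProg_updateProgram]
  refine (P.backwardPass.mem_dst_runProg_program s (.inl ⟨(j, τ), .inr k⟩)).trans ?_
  change (runProg _ _ _ s).eval (backwardArgs (.inl ⟨(j, τ), .inr k⟩)) = _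
  simp only [backwardArgs, MachineState.eval_map_toList,
    P.backwardPass.mem_unitReg_runProg_program, mul_one]

theorem mem_value_runProg_updateProgram (s : P.MachineState) (v : P.UDec) :
    (runProg R fixpt P.updateProgram s).mem (valueReg v) =
      ∑ i, s.mem (.strat v i) * (runProg R fixpt P.updateProgram s).mem (.gain v i) := by
  simp only [← mem_runProg_updateProgram_of_ne (R := R) (fixpt := fixpt) s (r := .strat _ _)
    (by simp) (by simp) (by simp) (by simp), mem_runProg_updateProgram]
  exact (P.backwardPass.mem_dst_runProg_program s (.inr v)).trans
    (MachineState.eval_map_toList _ _)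

variable {w : ℕ → P.Seq → ℝ}

theorem hist_stateAt (t : ℕ) (v : P.UDec) :
    (stateAt R fixpt P.playProgram P.updateProgram w t).hist v =
      history (fun s i =>
        (stateAt R fixpt P.playProgram P.updateProgram w (s + 1)).mem (.gain v i)) t := by
  induction t with
  | zero => rfl
  | succ t ih =>
    rw [history_succ, ← ih]
    exact (hist_runProg_updateProgram _ v).trans
      (congrArg (fun h => h v ++ _) (hist_runProg_playProgram _))

variable (R w) in
/-- The run of counterfactual regret minimization that the machine carries out: the results of each
iteration, read off from the registers. -/
noncomputable def machineRun (hfix : IsFixedPointOracle fixpt) : P.CFRRun R w :=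
  let played := playState R fixpt P.playProgram P.updateProgram w
  let updated t := stateAt R fixpt P.playProgram P.updateProgram w (t + 1)
  have hgen : ∀ t, Generates (fun v i => (played t).mem (.strat v i))
      fun e => (played t).mem (coordReg e) := fun _ => generates_runProg_playProgram _
  have hstrat : ∀ t v, (fun i => (played t).mem (.strat v i)) =
      (R v).next (history (fun s i => (updated s).mem (.gain v i)) t) := fun t v => by
    rw [← hist_stateAt t v]
    exact funext fun i => mem_strat_runProg_playProgram _ v i
  have hplay : ∀ t, (fun σ => (played t).mem (.play σ)) =
      fixpt (devMatrix fun e => (played t).mem (coordReg e)) :=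
    fun _ => funext fun σ => mem_play_runProg_playProgram _ σ
  have hfixed : ∀ t, fixpt (devMatrix fun e => (played t).mem (coordReg e)) ∈ P.coX ∧ _ :=
    fun t => hfix _ ((hgen t).mapsTo_coX fun v => by rw [hstrat]; exact (R v).next_mem _)
  { strat t v i := (played t).mem (.strat v i)
    dev t e := (played t).mem (coordReg e)
    x t σ := (played t).mem (.play σ)
    gain t v i := (updated t).mem (.gain v i)
    value t v := (updated t).mem (valueReg v)
    strat_eq := hstrat
    dev_root t := by rw [(hgen t).root, rootPoint_inl_root, if_pos rfl]
    dev_root_of_ne t τ hτ := by rw [(hgen t).root, rootPoint_inl_root, if_neg hτ]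
    dev_choice t := (hgen t).choice
    x_mem t := by rw [hplay]; exact (hfixed t).1
    x_fixed t := by rw [hplay]; exact (hfixed t).2
    gain_play t := mem_gain_play_runProg_updateProgram _
    gain_query t := mem_gain_query_runProg_updateProgram _
    value_eq t := mem_value_runProg_updateProgram _ }

theorem progCost_playProgram_add_updateProgram_le (f : ℕ) (ca ct : P.UDec → ℕ) :
    progCost f ca ct P.playProgram + progCost f ca ct P.updateProgram ≤
      f + ∑ v, (ca v + ct v) + 32 * P.size ^ 2 := by
  have hfix : progCost f ca ct [(.fix : P.Instr)] = P.size ^ 2 + P.size + f := by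
    simp [progCost, Instr.cost]
  have hsize : 1 ≤ P.size := Fintype.card_pos
  simp only [playProgram, updateProgram, progCost_append, progCost_ask, progCost_tell,
    Schedule.progCost_program, hfix, sum_add_distrib]
  have hforward := sum_cost_forwardPass_le (P := P)
  have hbackward := sum_cost_backwardPass_le (P := P)
  have hchoice := sum_card_choice_le (P := P)
  simp only [sum_add_distrib] at hforward hbackward
  nlinarith

theorem progCost_add_le_mul_cost_fix {p q : List P.Instr} {f K C : ℕ} {ca ct : P.UDec → ℕ}
    (h : progCost f ca ct p + progCost f ca ct q ≤ f + ∑ v, (ca v + ct v) + K * P.size ^ 2)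
    (hK : 1 ≤ K) (hC : ∀ v, ca v + ct v ≤ C * Fintype.card (P.Choice v)) :
    progCost f ca ct p + progCost f ca ct q ≤
      (K + 2 * C) * Instr.cost f ca ct (.fix : P.Instr) := by
  have hlocal : ∑ v, (ca v + ct v) ≤ C * (2 * P.size ^ 2) := by
    refine (sum_le_sum fun v _ => hC v).trans ?_
    rw [← mul_sum]
    exact Nat.mul_le_mul_left C sum_card_choice_le
  calc progCost f ca ct p + progCost f ca ct q
    _ ≤ f + C * (2 * P.size ^ 2) + K * P.size ^ 2 := by omega
    _ = f + (K + 2 * C) * P.size ^ 2 := by ring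
    _ ≤ (K + 2 * C) * f + (K + 2 * C) * P.size ^ 2 := by gcongr; nlinarith
    _ ≤ (K + 2 * C) * (P.size ^ 2 + P.size + f) := by nlinarith

end Iteration

end TreeFormDecisionProblem

theorem theorem2 :
    -- local regret minimizers with the rate used below exist
    (∀ (ι : Type u) [Fintype ι] [Nonempty ι],
      ∃ R : LocalMinimizer ι, R.HasRegret fun T => (Fintype.card ι : ℝ) * Real.sqrt T) ∧
    ∃ K : ℕ, ∀ P : TreeFormDecisionProblem.{u},
      -- the UTC polytope is a chain of scaled extensions, one simplex per UTC decision point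
      (∃ order : List P.UDec, order.Nodup ∧ (∀ v, v ∈ order) ∧
        ScaledExtensionChain P.rootPoint P.rootCoords
          (order.map fun v =>
            (Finset.univ.image (TreeFormDecisionProblem.choiceCoord v),
              TreeFormDecisionProblem.arrival v))
          Finset.univ P.utcPolytope) ∧
      -- correctness and regret of CFR with arbitrary local minimizers
      (∀ (R : ∀ v : P.UDec, LocalMinimizer (P.Choice v)) (w : ℕ → P.Seq → ℝ),
        (∀ t, P.IsUtility (w t)) → ∀ run : P.CFRRun R w,
        (∀ t, run.dev t ∈ P.utcPolytope ∧
          Set.MapsTo (TreeFormDecisionProblem.devMatrix (run.dev t)).mulVec P.coX P.coX ∧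
          (fun x : P.X => (TreeFormDecisionProblem.devMatrix (run.dev t)).mulVec x) ∈
            P.utcDeviations) ∧
        ∀ ρ : P.UDec → ℕ → ℝ, (∀ v, (R v).HasRegret (ρ v)) →
        ∀ π : ℕ → P.X → ℝ, (∀ t, π t ∈ stdSimplex ℝ P.X) →
          (∀ t, TreeFormDecisionProblem.mean (π t) = run.x t) →
        ∀ T : ℕ,
          (TreeFormDecisionProblem.PhiRegretLE P.utcDeviations π w T (∑ v, ρ v T) ∧
            TreeFormDecisionProblem.PhiRegretLE P.linearDeviations π w T (∑ v, ρ v T)) ∧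
          ∀ C : ℝ, 0 ≤ C → (∀ v, ρ v T ≤ C * Fintype.card (P.Choice v) * Real.sqrt T) →
            TreeFormDecisionProblem.PhiRegretLE P.utcDeviations π w T
              (2 * C * (P.size : ℝ) ^ 2 * Real.sqrt T) ∧
            TreeFormDecisionProblem.PhiRegretLE P.linearDeviations π w T
              (2 * C * (P.size : ℝ) ^ 2 * Real.sqrt T)) ∧
      -- every linear map from `co X` to `co X` has a fixed point, so that oracles exist
      (∃ fixpt : Matrix P.Seq P.Seq ℝ → P.Seq → ℝ,
        TreeFormDecisionProblem.IsFixedPointOracle fixpt) ∧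
      -- implementation: one fixed-point computation per iteration, and `O(d ^ 2)` other steps
      ∃ p q : List P.Instr,
        (∀ (R : ∀ v : P.UDec, LocalMinimizer (P.Choice v))
          (fixpt : Matrix P.Seq P.Seq ℝ → P.Seq → ℝ),
          TreeFormDecisionProblem.IsFixedPointOracle fixpt → ∀ w : ℕ → P.Seq → ℝ,
          ∃ run : P.CFRRun R w, ∀ t,
            run.x t = fixpt (TreeFormDecisionProblem.devMatrix (run.dev t)) ∧
            ∀ σ, (TreeFormDecisionProblem.playState R fixpt p q w t).mem (.play σ) = run.x t σ) ∧
        ∀ (f : ℕ) (ca ct : P.UDec → ℕ),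
          TreeFormDecisionProblem.progCost f ca ct p + TreeFormDecisionProblem.progCost f ca ct q
            ≤ f + (∑ v, (ca v + ct v)) + K * P.size ^ 2 ∧
          ∀ C : ℕ, (∀ v, ca v + ct v ≤ C * Fintype.card (P.Choice v)) →
            TreeFormDecisionProblem.progCost f ca ct p + TreeFormDecisionProblem.progCost f ca ct q
              ≤ (K + 2 * C) * TreeFormDecisionProblem.Instr.cost f ca ct (.fix : P.Instr) := by
  refine ⟨fun ι _ _ => exists_localMinimizer_hasRegret ι, 32, fun P =>
    ⟨P.exists_scaledExtensionChain, fun R w hw run => ⟨fun t => ?_, fun ρ hρ π _ hπ T => ?_⟩,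
      P.exists_isFixedPointOracle, P.playProgram, P.updateProgram, fun R fixpt hfix w => ?_,
      fun f ca ct => ?_⟩⟩
  · have hgen := run.generates t
    have hstrat := run.strat_mem_stdSimplex t
    exact ⟨run.dev_mem_utcPolytope t, hgen.mapsTo_coX hstrat, hgen.mem_utcDeviations hstrat⟩
  · have hregret := run.phiRegretLE hw hρ hπ T
    refine ⟨hregret, fun C hC hle => ?_⟩
    have hsum := TreeFormDecisionProblem.sum_le_two_mul_size_sq hC (Real.sqrt_nonneg T) hle
    exact ⟨hregret.1.mono hsum, hregret.2.mono hsum⟩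
  · exact ⟨TreeFormDecisionProblem.machineRun R w hfix, fun t =>
      ⟨funext (TreeFormDecisionProblem.mem_play_runProg_playProgram _), fun _ => rfl⟩⟩
  · have hcost := TreeFormDecisionProblem.progCost_playProgram_add_updateProgram_le f ca ct
    exact ⟨hcost, fun C hC =>
      TreeFormDecisionProblem.progCost_add_le_mul_cost_fix hcost (by norm_num) hC⟩
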